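/- Let $R$ and $S$ be associative rings with unit, and let ${}_R\omega_S$ be a semidualizing bimodule, that is, an $(R,S)$-bimodule such that ${}_R\omega$ and $\omega_S$ both admit projective resolutions by finitely generated projective modules, the homothety maps $R\to\mathrm{Hom}_{S^{op}}(\omega,\omega)$ and $S\to\mathrm{Hom}_R(\omega,\omega)$ are isomorphisms, and $\mathrm{Ext}_R^{i}(\omega,\omega)=0=\mathrm{Ext}_{S^{op}}^{i}(\omega,\omega)$ for all $i\ge 1$. For a left $R$-module $M$, let $0\to M\to I^0\xrightarrow{f^0} I^1$ be the beginning of a minimal injective resolution of $M$ and put $\mathrm{cTr}_\omega M=\mathrm{Coker}\bigl(\mathrm{Hom}_R(\omega,f^0)\bigr)$, a left $S$-module. The module $M$ is called $n$-$\omega$-cotorsionfree if $\mathrm{Tor}_i^S(\omega,\mathrm{cTr}_\omega M)=0$ for $1\le i\le n$, and $\infty$-$\omega$-cotorsionfree if it is $n$-$\omega$-cotorsionfree for all $n$. Let $\mathrm{c}\mathcal{T}(R)$ be the full subcategory of left $R$-modules whose objects are the $\infty$-$\omega$-cotorsionfree modules. A left $S$-module $N$ is called $\omega$-adstatic if the canonical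 homomorphism $\mu_N:N\to\mathrm{Hom}_R(\omega,\omega\otimes_S N)$, $\mu_N(y)(x)=x\otimes y$, is an isomorphism. Put $\omega^+=\mathrm{Hom}_{\mathbb Z}(\omega,\mathbb Q/\mathbb Z)$, a left $S$-module, and let $\mathcal{H}(\omega)$ be the full subcategory of left $S$-modules whose objects are the $\omega$-adstatic modules $N$ with $\mathrm{Ext}_S^{i}(N,\omega^+)=0$ for all $i\ge 1$. Then $\mathrm{Hom}_R(\omega,-)$ maps $\mathrm{c}\mathcal{T}(R)$ into $\mathcal{H}(\omega)$, $\omega\otimes_S-$ maps $\mathcal{H}(\omega)$ into $\mathrm{c}\mathcal{T}(R)$, and the resulting functors $\mathrm{c}\mathcal{T}(R)\rightleftarrows\mathcal{H}(\omega)$ are mutually quasi-inverse equivalences of categories. -/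

import Mathlib

open CategoryTheory MulOpposite
open scoped TensorProduct

universe u

/-! An `(R, S)`-bimodule `ω` is given by `[Module R ω] [Module Sᵐᵒᵖ ω] [SMulCommClass R Sᵐᵒᵖ ω]`;
the right action is `x · s = op s • x`. -/

namespace Semidualizing

noncomputable section

section Homothety

variable {R S ω : Type u} [Ring R] [Ring S] [AddCommGroup ω] [Module R ω] [Module Sᵐᵒᵖ ω]
variable [SMulCommClass R Sᵐᵒᵖ ω]

variable (S ω) in
/-- Left multiplication by `r` on `ω`, a homomorphism of right `S`-modules. -/
def leftHomothety (r : R) : ω →ₗ[Sᵐᵒᵖ] ω where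
  toFun x := r • x
  map_add' := smul_add r
  map_smul' s x := smul_comm r s x

variable (R ω) in
/-- Right multiplication by `s` on `ω`, a homomorphism of left `R`-modules. -/
def rightHomothety (s : S) : ω →ₗ[R] ω where
  toFun x := op s • x
  map_add' := smul_add (op s)
  map_smul' r x := (smul_comm r (op s) x).symm

end Homothety

section Hom

/-- `Hom_R(ω, M)`, with the left `S`-module structure `(s • f) x = f (x · s)` below. -/
def RHom (R ω M : Type u) [Ring R] [AddCommGroup ω] [Module R ω] [AddCommGroup M] [Module R M] :
    Type u := ω →ₗ[R] M

variable {R ω M : Type u} [Ring R] [AddCommGroup ω] [Module R ω] [AddCommGroup M] [Module R M]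

instance : AddCommGroup (RHom R ω M) := inferInstanceAs (AddCommGroup (ω →ₗ[R] M))

instance : FunLike (RHom R ω M) ω M := inferInstanceAs (FunLike (ω →ₗ[R] M) ω M)

@[ext] theorem RHom.ext {f g : RHom R ω M} (h : ∀ x, f x = g x) : f = g := DFunLike.ext _ _ h

variable {S : Type u} [Ring S] [Module Sᵐᵒᵖ ω] [SMulCommClass R Sᵐᵒᵖ ω]

instance : Module S (RHom R ω M) where
  smul s f := LinearMap.comp (f : ω →ₗ[R] M) (rightHomothety R ω s)
  one_smul f := RHom.ext fun x => congrArg f (one_smul Sᵐᵒᵖ x)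
  mul_smul s t f := RHom.ext fun x => congrArg f (mul_smul (op t) (op s) x)
  smul_zero _ := rfl
  smul_add _ _ _ := rfl
  add_smul s t f := RHom.ext fun x =>
    (congrArg f (add_smul (op s) (op t) x)).trans (LinearMap.map_add (f : ω →ₗ[R] M) _ _)
  zero_smul f := RHom.ext fun x =>
    (congrArg f (zero_smul Sᵐᵒᵖ x)).trans (LinearMap.map_zero (f : ω →ₗ[R] M))

theorem RHom.smul_apply (s : S) (f : RHom R ω M) (x : ω) : (s • f) x = f (op s • x) := rfl

/-- Post-composition with `g : M → M'`, as an `S`-linear map `Hom_R(ω, M) → Hom_R(ω, M')`. -/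
def RHom.map (S : Type u) [Ring S] [Module Sᵐᵒᵖ ω] [SMulCommClass R Sᵐᵒᵖ ω]
    {M' : Type u} [AddCommGroup M'] [Module R M'] (g : M →ₗ[R] M') :
    RHom R ω M →ₗ[S] RHom R ω M' where
  toFun f := g.comp (f : ω →ₗ[R] M)
  map_add' f f' := LinearMap.comp_add (f : ω →ₗ[R] M) (f' : ω →ₗ[R] M) g
  map_smul' _ _ := rfl

end Hom

section Tensor

variable (R S ω : Type u) [Ring R] [Ring S] [AddCommGroup ω] [Module R ω] [Module Sᵐᵒᵖ ω]
variable (N : Type u) [AddCommGroup N] [Module S N]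

/-- The `R`-submodule of `ω ⊗_ℤ N` generated by the elements `(x · s) ⊗ y - x ⊗ (s • y)`. When `ω`
is a bimodule, multiplying such an element by `r : R` gives another one, so this is also the
subgroup generated by them. -/
def balancing : Submodule R (ω ⊗[ℤ] N) :=
  Submodule.span R {t | ∃ (x : ω) (s : S) (y : N), t = (op s • x) ⊗ₜ[ℤ] y - x ⊗ₜ[ℤ] (s • y)}

/-- The tensor product `ω ⊗_S N`, a left `R`-module through `r • (x ⊗ y) = (r • x) ⊗ y`. -/
def Tens : Type u := (ω ⊗[ℤ] N) ⧸ balancing R S ω N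

instance : AddCommGroup (Tens R S ω N) :=
  inferInstanceAs (AddCommGroup ((ω ⊗[ℤ] N) ⧸ balancing R S ω N))

instance : Module R (Tens R S ω N) :=
  inferInstanceAs (Module R ((ω ⊗[ℤ] N) ⧸ balancing R S ω N))

variable {N}

/-- The elementary tensor `x ⊗ y` in `ω ⊗_S N`. -/
def Tens.tmul (x : ω) (y : N) : Tens R S ω N :=
  (balancing R S ω N).mkQ (x ⊗ₜ[ℤ] y)

theorem Tens.tmul_add (x : ω) (y y' : N) :
    Tens.tmul R S ω x (y + y') = Tens.tmul R S ω x y + Tens.tmul R S ω x y' := by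
  unfold Tens.tmul
  rw [TensorProduct.tmul_add]
  exact map_add _ _ _

theorem Tens.add_tmul (x x' : ω) (y : N) :
    Tens.tmul R S ω (x + x') y = Tens.tmul R S ω x y + Tens.tmul R S ω x' y := by
  unfold Tens.tmul
  rw [TensorProduct.add_tmul]
  exact map_add _ _ _

theorem Tens.smul_tmul (r : R) (x : ω) (y : N) :
    Tens.tmul R S ω (r • x) y = r • Tens.tmul R S ω x y := rfl

theorem Tens.op_smul_tmul (s : S) (x : ω) (y : N) :
    Tens.tmul R S ω (op s • x) y = Tens.tmul R S ω x (s • y) :=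
  (Submodule.Quotient.eq _).2 (Submodule.subset_span ⟨x, s, y, rfl⟩)

/-- The homomorphism `ω ⊗_S N → ω ⊗_S N'`, `x ⊗ y ↦ x ⊗ g y`. -/
def Tens.map {N' : Type u} [AddCommGroup N'] [Module S N'] (g : N →ₗ[S] N') :
    Tens R S ω N →ₗ[R] Tens R S ω N' :=
  Submodule.mapQ (balancing R S ω N) (balancing R S ω N')
    (TensorProduct.AlgebraTensorModule.map (LinearMap.id : ω →ₗ[R] ω) (g.restrictScalars ℤ)) <| by
      refine Submodule.span_le.2 ?_
      rintro _ ⟨x, s, y, rfl⟩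
      refine Submodule.subset_span ⟨x, s, g y, ?_⟩
      simp

theorem Tens.map_tmul {N' : Type u} [AddCommGroup N'] [Module S N'] (g : N →ₗ[S] N')
    (x : ω) (y : N) : Tens.map R S ω g (Tens.tmul R S ω x y) = Tens.tmul R S ω x (g y) := rfl

theorem Tens.hom_ext {P : Type u} [AddCommGroup P] [Module R P] {f g : Tens R S ω N →ₗ[R] P}
    (h : ∀ x y, f (Tens.tmul R S ω x y) = g (Tens.tmul R S ω x y)) : f = g := by
  refine LinearMap.ext fun t => ?_
  obtain ⟨t, rfl⟩ := (balancing R S ω N).mkQ_surjective t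
  induction t using TensorProduct.induction_on with
  | zero => exact (map_zero f).trans (map_zero g).symm
  | tmul x y => exact h x y
  | add a b ha hb =>
    rw [map_add]
    exact (map_add f _ _).trans ((congrArg₂ (· + ·) ha hb).trans (map_add g _ _).symm)

end Tensor

section Functors

variable (R S ω : Type u) [Ring R] [Ring S] [AddCommGroup ω] [Module R ω] [Module Sᵐᵒᵖ ω]

/-- The functor `Hom_R(ω, -)` from left `R`-modules to left `S`-modules. -/
def homFunctor [SMulCommClass R Sᵐᵒᵖ ω] : ModuleCat.{u} R ⥤ ModuleCat.{u} S where
  obj M := ModuleCat.of S (RHom R ω M)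
  map g := ModuleCat.ofHom (RHom.map S g.hom)

/-- The functor `ω ⊗_S -` from left `S`-modules to left `R`-modules. -/
def tensorFunctor : ModuleCat.{u} S ⥤ ModuleCat.{u} R where
  obj N := ModuleCat.of R (Tens R S ω N)
  map g := ModuleCat.ofHom (Tens.map R S ω g.hom)
  map_id _ := ModuleCat.hom_ext (Tens.hom_ext R S ω fun _ _ => rfl)
  map_comp _ _ := ModuleCat.hom_ext (Tens.hom_ext R S ω fun _ _ => rfl)

instance : (tensorFunctor R S ω).Additive where
  map_add := ModuleCat.hom_ext (Tens.hom_ext R S ω fun x _ => Tens.tmul_add R S ω x _ _)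

/-- `Tor_i^S(ω, N)`, the value at `N` of the `i`-th left derived functor of `ω ⊗_S -`. -/
def Tor (i : ℕ) (N : ModuleCat.{u} S) : ModuleCat.{u} R :=
  ((tensorFunctor R S ω).leftDerived i).obj N

end Functors

section Dual

/-- `ω⁺ = Hom_ℤ(ω, ℚ/ℤ)`, with the left `S`-module structure `(s • f) x = f (x · s)` below. -/
def CharDual (ω : Type u) [AddCommGroup ω] : Type u := ω →+ AddCircle (1 : ℚ)

variable {S ω : Type u} [Ring S] [AddCommGroup ω] [Module Sᵐᵒᵖ ω]

instance : AddCommGroup (CharDual ω) := inferInstanceAs (AddCommGroup (ω →+ AddCircle (1 : ℚ)))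

instance : FunLike (CharDual ω) ω (AddCircle (1 : ℚ)) :=
  inferInstanceAs (FunLike (ω →+ AddCircle (1 : ℚ)) ω (AddCircle (1 : ℚ)))

@[ext] theorem CharDual.ext {f g : CharDual ω} (h : ∀ x, f x = g x) : f = g := DFunLike.ext _ _ h

instance : Module S (CharDual ω) where
  smul s f := AddMonoidHom.comp (f : ω →+ AddCircle (1 : ℚ)) (DistribSMul.toAddMonoidHom ω (op s))
  one_smul f := CharDual.ext fun x => congrArg f (one_smul Sᵐᵒᵖ x)
  mul_smul s t f := CharDual.ext fun x => congrArg f (mul_smul (op t) (op s) x)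
  smul_zero _ := rfl
  smul_add _ _ _ := rfl
  add_smul s t f := CharDual.ext fun x =>
    (congrArg f (add_smul (op s) (op t) x)).trans
      (AddMonoidHom.map_add (f : ω →+ AddCircle (1 : ℚ)) _ _)
  zero_smul f := CharDual.ext fun x =>
    (congrArg f (zero_smul Sᵐᵒᵖ x)).trans (AddMonoidHom.map_zero (f : ω →+ AddCircle (1 : ℚ)))

theorem CharDual.smul_apply (s : S) (f : CharDual ω) (x : ω) : (s • f) x = f (op s • x) := rfl

end Dual

section Classes

variable (R S ω : Type u) [Ring R] [Ring S] [AddCommGroup ω] [Module R ω] [Module Sᵐᵒᵖ ω]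

/-- The `A`-module `X` has a projective resolution by finitely generated projective modules. -/
def HasDegreewiseFiniteResolution (A X : Type u) [Ring A] [AddCommGroup X] [Module A X] : Prop :=
  ∃ P : ProjectiveResolution (ModuleCat.of A X), ∀ n, Module.Finite A (P.complex.X n)

/-- The bimodule `ω` is semidualizing. Right `S`-modules are left `Sᵐᵒᵖ`-modules. -/
structure IsSemidualizing [SMulCommClass R Sᵐᵒᵖ ω] : Prop where
  finite_left : HasDegreewiseFiniteResolution R ω
  finite_right : HasDegreewiseFiniteResolution Sᵐᵒᵖ ω
  /-- The homothety map `R → Hom_{Sᵒᵖ}(ω, ω)`, `r ↦ (x ↦ r • x)`, is an isomorphism. -/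
  homothety_left : Function.Bijective fun r : R => leftHomothety S ω r
  /-- The homothety map `S → Hom_R(ω, ω)`, `s ↦ (x ↦ x · s)`, is an isomorphism. -/
  homothety_right : Function.Bijective fun s : S => rightHomothety R ω s
  ext_left : ∀ i : ℕ, 1 ≤ i →
    Subsingleton (Abelian.Ext (ModuleCat.of R ω) (ModuleCat.of R ω) i)
  ext_right : ∀ i : ℕ, 1 ≤ i →
    Subsingleton (Abelian.Ext (ModuleCat.of Sᵐᵒᵖ ω) (ModuleCat.of Sᵐᵒᵖ ω) i)

/-- A submodule is essential if it meets every nonzero submodule nontrivially. -/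
def IsEssential {A X : Type u} [Ring A] [AddCommGroup X] [Module A X] (E : Submodule A X) : Prop :=
  ∀ K : Submodule A X, K ⊓ E = ⊥ → K = ⊥

variable {R} in
/-- The beginning `0 → M → I⁰ → I¹` of a minimal injective resolution of `M`: an exact sequence
in which `M → I⁰` is an injective envelope of `M` and the inclusion of the image of `I⁰ → I¹`
is an injective envelope of that image. -/
structure MinimalInjectiveCopresentation (M : ModuleCat.{u} R) where
  I₀ : ModuleCat.{u} R
  I₁ : ModuleCat.{u} R
  ε : M ⟶ I₀
  f : I₀ ⟶ I₁
  injective₀ : Injective I₀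
  injective₁ : Injective I₁
  ε_injective : Function.Injective ε
  exact : Function.Exact ε f
  essential₀ : IsEssential (LinearMap.range ε.hom)
  essential₁ : IsEssential (LinearMap.range f.hom)

variable {R} in
/-- The cotranspose `cTr_ω M`, the cokernel of `Hom_R(ω, I⁰) → Hom_R(ω, I¹)`, computed from the
minimal injective copresentation `P` of `M` (which is unique up to isomorphism). -/
def cotranspose [SMulCommClass R Sᵐᵒᵖ ω] {M : ModuleCat.{u} R}
    (P : MinimalInjectiveCopresentation M) : ModuleCat.{u} S :=
  ModuleCat.of S (RHom R ω P.I₁ ⧸ LinearMap.range (RHom.map (ω := ω) S P.f.hom))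

variable {R} in
/-- `M` is `n`-`ω`-cotorsionfree: `Tor_i^S(ω, cTr_ω M) = 0` for `1 ≤ i ≤ n`. -/
def IsCotorsionfree [SMulCommClass R Sᵐᵒᵖ ω] (n : ℕ) (M : ModuleCat.{u} R) : Prop :=
  ∃ P : MinimalInjectiveCopresentation M,
    ∀ i : ℕ, 1 ≤ i → i ≤ n → Limits.IsZero (Tor R S ω i (cotranspose S ω P))

/-- The class `cT(R)` of `∞`-`ω`-cotorsionfree left `R`-modules. -/
def cT [SMulCommClass R Sᵐᵒᵖ ω] : ObjectProperty (ModuleCat.{u} R) :=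
  fun M => ∀ n : ℕ, IsCotorsionfree S ω n M

/-- The canonical homomorphism `μ_N : N → Hom_R(ω, ω ⊗_S N)`, `μ_N(y)(x) = x ⊗ y`. -/
def μ [SMulCommClass R Sᵐᵒᵖ ω] (N : Type u) [AddCommGroup N] [Module S N] :
    N →ₗ[S] RHom R ω (Tens R S ω N) where
  toFun y :=
    ({ toFun := fun x => Tens.tmul R S ω x y
       map_add' := fun x x' => Tens.add_tmul R S ω x x' y
       map_smul' := fun r x => Tens.smul_tmul R S ω r x y } : ω →ₗ[R] Tens R S ω N)
  map_add' y y' := RHom.ext fun x => Tens.tmul_add R S ω x y y'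
  map_smul' s y := RHom.ext fun x => (Tens.op_smul_tmul R S ω s x y).symm

/-- `N` is `ω`-adstatic if `μ_N` is an isomorphism. -/
def IsAdstatic [SMulCommClass R Sᵐᵒᵖ ω] (N : ModuleCat.{u} S) : Prop :=
  Function.Bijective (μ R S ω N)

/-- The class `H(ω)` of `ω`-adstatic left `S`-modules `N` with `Ext_S^i(N, ω⁺) = 0` for `i ≥ 1`. -/
def H [SMulCommClass R Sᵐᵒᵖ ω] : ObjectProperty (ModuleCat.{u} S) :=
  fun N => IsAdstatic R S ω N ∧
    ∀ i : ℕ, 1 ≤ i → Subsingleton (Abelian.Ext N (ModuleCat.of S (CharDual ω)) i)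

end Classes

end

end Semidualizing

/-! The functors form an adjoint pair with unit `μ` and counit `θ`, so the equivalence follows once
both classes are described by these maps. The key is `cT_iff`: `M` lies in `cT` exactly when `θ_M`
is bijective and `Ext^i(Hom_R(ω, M), ω⁺) = 0` for `i ≥ 1`. The triangle identities show that `θ` is
bijective at `ω ⊗ N` for adstatic `N`, and `μ` at `Hom_R(ω, M)` when `θ_M` is, so each functor lands
in the other class.

Character duality `(ω ⊗ N)⁺ ≃ Hom_S(N, ω⁺)` turns vanishing of `Tor` into vanishing of `Ext` into
`ω⁺` (`isZero_tor_iff`). For `cT_iff`, apply `Hom_R(ω, -)` to `0 → M → I⁰ → I¹`, and let `K` be the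
image of `Hom_R(ω, I⁰) → Hom_R(ω, I¹)`. For injective `I`, `θ_I` is bijective and `Hom_R(ω, I)` has
no higher `Ext` into `ω⁺`. Hence degrees `≥ 3` for the cotranspose shift by two to `Hom_R(ω, M)`,
while degrees 1 and 2 say that `ω ⊗ -` keeps `K → Hom_R(ω, I¹)` and `Hom_R(ω, M) → Hom_R(ω, I⁰)`
injective. A diagram chase identifies the latter with bijectivity of `θ_M`.

The facts about injective `I` come from the evaluation `X ⊗_S Hom_R(ω, I) → Hom_R(Hom(X, ω), I)`, an
isomorphism for finitely presented right modules `X`. It is used only through its character dual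
`evalDual`, and its behaviour along the syzygies of `ω` gives the vanishing of `Ext`. -/

namespace Semidualizing

noncomputable section

/-! ### Dimension shifting for `Ext` along short exact sequences -/

section ExtModules

variable {A : Type u} [Ring A] {X₁ X₂ X₃ Y : Type u}
  [AddCommGroup X₁] [AddCommGroup X₂] [AddCommGroup X₃] [AddCommGroup Y]
  [Module A X₁] [Module A X₂] [Module A X₃] [Module A Y]
  {f : X₁ →ₗ[A] X₂} {g : X₂ →ₗ[A] X₃}

theorem shortExact_of_exact (hf : Function.Injective f) (hfg : Function.Exact f g)
    (hg : Function.Surjective g) :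
    (ModuleCat.shortComplexOfCompEqZero f g hfg.linearMap_comp_eq_zero).ShortExact :=
  ModuleCat.shortComplex_shortExact _ hfg hf hg

/-- If `Ext¹(X₃, Y) = 0`, then homomorphisms `X₁ → Y` extend to `X₂`. -/
theorem exists_extension_of_subsingleton_ext (hf : Function.Injective f)
    (hfg : Function.Exact f g) (hg : Function.Surjective g)
    (h : Subsingleton (Abelian.Ext (ModuleCat.of A X₃) (ModuleCat.of A Y) 1)) (φ : X₁ →ₗ[A] Y) :
    ∃ ψ : X₂ →ₗ[A] Y, ψ ∘ₗ f = φ := by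
  obtain ⟨x, hx⟩ := Abelian.Ext.contravariant_sequence_exact₁ (shortExact_of_exact hf hfg hg)
    (ModuleCat.of A Y) (Abelian.Ext.mk₀ (ModuleCat.ofHom φ)) (n₁ := 1) rfl
    (h.elim (α := Abelian.Ext (ModuleCat.of A X₃) (ModuleCat.of A Y) 1) _ _)
  obtain ⟨ψ, rfl⟩ := (Abelian.Ext.mk₀_bijective _ _).2 x
  rw [Abelian.Ext.mk₀_comp_mk₀] at hx
  exact ⟨ψ.hom, congrArg ModuleCat.Hom.hom ((Abelian.Ext.mk₀_bijective _ _).1 hx)⟩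

/-- As `Ext¹(X₂, Y) = 0`, every class comes from a map `X₁ → Y` by the connecting homomorphism,
which kills maps that extend to `X₂`. -/
theorem subsingleton_ext_one_of_exists_extension (hf : Function.Injective f)
    (hfg : Function.Exact f g) (hg : Function.Surjective g)
    (h : Subsingleton (Abelian.Ext (ModuleCat.of A X₂) (ModuleCat.of A Y) 1))
    (hext : ∀ φ : X₁ →ₗ[A] Y, ∃ ψ : X₂ →ₗ[A] Y, ψ ∘ₗ f = φ) :
    Subsingleton (Abelian.Ext (ModuleCat.of A X₃) (ModuleCat.of A Y) 1) := by
  refine subsingleton_of_forall_eq 0 fun x => ?_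
  have hS := shortExact_of_exact hf hfg hg
  obtain ⟨y, rfl⟩ := Abelian.Ext.contravariant_sequence_exact₃ hS (ModuleCat.of A Y) x
    (h.elim (α := Abelian.Ext (ModuleCat.of A X₂) (ModuleCat.of A Y) 1) _ _) (n₀ := 0) rfl
  obtain ⟨φ, rfl⟩ := (Abelian.Ext.mk₀_bijective _ _).2 y
  obtain ⟨ψ, hψ⟩ := hext φ.hom
  have : φ = ModuleCat.ofHom f ≫ ModuleCat.ofHom ψ := ModuleCat.hom_ext hψ.symm
  rw [this, ← Abelian.Ext.mk₀_comp_mk₀]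
  exact hS.extClass_comp_assoc _

theorem subsingleton_ext_succ_of_fst (hf : Function.Injective f)
    (hfg : Function.Exact f g) (hg : Function.Surjective g) (n : ℕ)
    (h₂ : Subsingleton (Abelian.Ext (ModuleCat.of A X₂) (ModuleCat.of A Y) (n + 1)))
    (h₁ : Subsingleton (Abelian.Ext (ModuleCat.of A X₁) (ModuleCat.of A Y) n)) :
    Subsingleton (Abelian.Ext (ModuleCat.of A X₃) (ModuleCat.of A Y) (n + 1)) := by
  refine subsingleton_of_forall_eq 0 fun x => ?_
  obtain ⟨y, rfl⟩ := Abelian.Ext.contravariant_sequence_exact₃ (shortExact_of_exact hf hfg hg)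
    (ModuleCat.of A Y) x
    (h₂.elim (α := Abelian.Ext (ModuleCat.of A X₂) (ModuleCat.of A Y) (n + 1)) _ _)
    (n₀ := n) (add_comm 1 n)
  rw [h₁.elim (α := Abelian.Ext (ModuleCat.of A X₁) (ModuleCat.of A Y) n) y 0,
    Abelian.Ext.comp_zero]

theorem subsingleton_ext_of_trd (hf : Function.Injective f)
    (hfg : Function.Exact f g) (hg : Function.Surjective g) (n : ℕ)
    (h₂ : Subsingleton (Abelian.Ext (ModuleCat.of A X₂) (ModuleCat.of A Y) n))
    (h₃ : Subsingleton (Abelian.Ext (ModuleCat.of A X₃) (ModuleCat.of A Y) (n + 1))) :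
    Subsingleton (Abelian.Ext (ModuleCat.of A X₁) (ModuleCat.of A Y) n) := by
  refine subsingleton_of_forall_eq 0 fun x => ?_
  obtain ⟨y, rfl⟩ := Abelian.Ext.contravariant_sequence_exact₁ (shortExact_of_exact hf hfg hg)
    (ModuleCat.of A Y) x (n₁ := n + 1) (add_comm 1 n)
    (h₃.elim (α := Abelian.Ext (ModuleCat.of A X₃) (ModuleCat.of A Y) (n + 1)) _ _)
  rw [h₂.elim (α := Abelian.Ext (ModuleCat.of A X₂) (ModuleCat.of A Y) n) y 0,
    Abelian.Ext.comp_zero]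

/-- If `X₂` is injective and homomorphisms `Y → X₃` lift to `X₂`, then `Ext¹(Y, X₁) = 0`. -/
theorem subsingleton_ext_one_of_exists_lift (hf : Function.Injective f)
    (hfg : Function.Exact f g) (hg : Function.Surjective g) (h : Module.Injective A X₂)
    (hext : ∀ φ : Y →ₗ[A] X₃, ∃ ψ : Y →ₗ[A] X₂, g ∘ₗ ψ = φ) :
    Subsingleton (Abelian.Ext (ModuleCat.of A Y) (ModuleCat.of A X₁) 1) := by
  refine subsingleton_of_forall_eq 0 fun x => ?_
  have hS := shortExact_of_exact hf hfg hg
  have : Injective (ModuleCat.of A X₂) := (Module.injective_iff_injective_object A X₂).1 h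
  obtain ⟨y, rfl⟩ := Abelian.Ext.covariant_sequence_exact₁ (ModuleCat.of A Y) hS x
    (Abelian.Ext.eq_zero_of_injective (I := ModuleCat.of A X₂) _) (n₀ := 0) rfl
  obtain ⟨φ, rfl⟩ := (Abelian.Ext.mk₀_bijective _ _).2 y
  obtain ⟨ψ, hψ⟩ := hext φ.hom
  have : φ = ModuleCat.ofHom ψ ≫ ModuleCat.ofHom g := ModuleCat.hom_ext hψ.symm
  rw [this, ← Abelian.Ext.mk₀_comp_mk₀, Abelian.Ext.comp_assoc (a₂₃ := 1) (h := rfl) (h₂₃ := rfl)]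
  exact (congrArg (fun z => (Abelian.Ext.mk₀ (ModuleCat.ofHom ψ)).comp z (zero_add 1))
    hS.comp_extClass).trans (Abelian.Ext.comp_zero ..)

theorem subsingleton_ext_succ_of_trd (hf : Function.Injective f)
    (hfg : Function.Exact f g) (hg : Function.Surjective g) (n : ℕ) (h : Module.Injective A X₂)
    (h₃ : Subsingleton (Abelian.Ext (ModuleCat.of A Y) (ModuleCat.of A X₃) n)) :
    Subsingleton (Abelian.Ext (ModuleCat.of A Y) (ModuleCat.of A X₁) (n + 1)) := by
  refine subsingleton_of_forall_eq 0 fun x => ?_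
  have : Injective (ModuleCat.of A X₂) := (Module.injective_iff_injective_object A X₂).1 h
  obtain ⟨y, rfl⟩ := Abelian.Ext.covariant_sequence_exact₁ (ModuleCat.of A Y)
    (shortExact_of_exact hf hfg hg) x
    (Abelian.Ext.eq_zero_of_injective (I := ModuleCat.of A X₂) _) (n₀ := n) rfl
  rw [h₃.elim (α := Abelian.Ext (ModuleCat.of A Y) (ModuleCat.of A X₃) n) y 0,
    Abelian.Ext.zero_comp]

end ExtModules

/-! ### Characters with values in `ℚ/ℤ` detect exactness -/

section Characters

variable {X Y Z : Type u} [AddCommGroup X] [AddCommGroup Y] [AddCommGroup Z]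

theorem exists_character_extension (f : X →+ Y) (hf : Function.Injective f)
    (χ : X →+ AddCircle (1 : ℚ)) : ∃ ψ : Y →+ AddCircle (1 : ℚ), ψ.comp f = χ :=
  CharacterModule.dual_surjective_of_injective f.toIntLinearMap hf χ

theorem eq_zero_of_characters {x : X} (h : ∀ χ : X →+ AddCircle (1 : ℚ), χ x = 0) : x = 0 :=
  CharacterModule.eq_zero_of_character_apply h

/-- A character vanishing on the kernel of `g` factors through `g`. -/
theorem exists_character_factor (g : X →+ Y) (χ : X →+ AddCircle (1 : ℚ))
    (hχ : ∀ x, g x = 0 → χ x = 0) : ∃ ψ : Y →+ AddCircle (1 : ℚ), ψ.comp g = χ := by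
  obtain ⟨ψ, hψ⟩ := exists_character_extension (QuotientAddGroup.kerLift g)
    (QuotientAddGroup.kerLift_injective g) (QuotientAddGroup.lift g.ker χ hχ)
  exact ⟨ψ, AddMonoidHom.ext fun x => DFunLike.congr_fun hψ (x : X ⧸ g.ker)⟩

theorem injective_of_characters_surjective (f : X →+ Y)
    (h : ∀ χ : X →+ AddCircle (1 : ℚ), ∃ ψ : Y →+ AddCircle (1 : ℚ), ψ.comp f = χ) :
    Function.Injective f := by
  refine (injective_iff_map_eq_zero f).2 fun x hx => eq_zero_of_characters fun χ => ?_
  obtain ⟨ψ, rfl⟩ := h χ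
  simp [hx]

theorem surjective_of_characters_injective (f : X →+ Y)
    (h : ∀ χ : Y →+ AddCircle (1 : ℚ), χ.comp f = 0 → χ = 0) :
    Function.Surjective f := by
  intro y
  rw [← AddMonoidHom.mem_range, ← QuotientAddGroup.eq_zero_iff]
  refine eq_zero_of_characters fun χ => ?_
  refine DFunLike.congr_fun (h (χ.comp (QuotientAddGroup.mk' f.range)) ?_) y
  ext x
  have : ((f x : Y) : Y ⧸ f.range) = 0 := (QuotientAddGroup.eq_zero_iff _).2 ⟨x, rfl⟩
  simp [this]

/-- A failure of exactness at `Y` would be a nonzero class in `Y / range f`, and some character of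
this quotient would detect it. -/
theorem exact_of_characters (f : X →+ Y) (g : Y →+ Z)
    (h : ∀ χ : Y →+ AddCircle (1 : ℚ), χ.comp f = 0 →
      ∃ ψ : Z →+ AddCircle (1 : ℚ), ψ.comp g = χ) (y : Y) (hy : g y = 0) :
    ∃ x, f x = y := by
  change y ∈ f.range
  rw [← QuotientAddGroup.eq_zero_iff]
  refine eq_zero_of_characters fun χ => ?_
  obtain ⟨ψ, hψ⟩ := h (χ.comp (QuotientAddGroup.mk' f.range)) (by
    ext x
    have : ((f x : Y) : Y ⧸ f.range) = 0 := (QuotientAddGroup.eq_zero_iff _).2 ⟨x, rfl⟩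
    simp [this])
  have := DFunLike.congr_fun hψ y
  simpa [hy] using this.symm

end Characters

/-! ### Duality between tensoring with `ω` and mapping to `ω⁺` -/

section TensorDual

variable (R S ω : Type u) [Ring R] [Ring S] [AddCommGroup ω] [Module R ω] [Module Sᵐᵒᵖ ω]
variable {N N' : Type u} [AddCommGroup N] [Module S N] [AddCommGroup N'] [Module S N']

theorem Tens.induction {p : Tens R S ω N → Prop} (tmul : ∀ x y, p (Tens.tmul R S ω x y))
    (add : ∀ a b, p a → p b → p (a + b)) (t : Tens R S ω N) : p t := by
  obtain ⟨t, rfl⟩ := (balancing R S ω N).mkQ_surjective t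
  induction t using TensorProduct.induction_on with
  | zero => simpa [Tens.tmul] using tmul 0 0
  | tmul x y => exact tmul x y
  | add a b ha hb =>
    rw [map_add]
    exact add _ _ ha hb

theorem Tens.addHom_ext {P : Type*} [AddCommGroup P] {f g : Tens R S ω N →+ P}
    (h : ∀ x y, f (Tens.tmul R S ω x y) = g (Tens.tmul R S ω x y)) : f = g := by
  refine AddMonoidHom.ext fun t =>
    Tens.induction R S ω (p := fun t => f t = g t) h (fun a b ha hb => ?_) t
  rw [map_add, map_add, ha, hb]

variable [SMulCommClass R Sᵐᵒᵖ ω]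

/-- The homomorphism out of `ω ⊗_S N` given by a balanced biadditive map. -/
def Tens.liftAdd {P : Type*} [AddCommGroup P] (β : ω →+ N →+ P)
    (hβ : ∀ (x : ω) (s : S) (y : N), β (op s • x) y = β x (s • y)) : Tens R S ω N →+ P :=
  QuotientAddGroup.lift (balancing R S ω N).toAddSubgroup
    (TensorProduct.liftAddHom β fun n x y => by simp) <| by
      -- `balancing` is an `R`-span but the map is only additive, so the induction must carry all
      -- multiples `r • t`.
      suffices ∀ t ∈ balancing R S ω N, ∀ r : R,
          TensorProduct.liftAddHom β (fun n x y => by simp) (r • t) = 0 by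
        intro t ht
        simpa using this t ht 1
      intro t ht
      induction ht using Submodule.span_induction with
      | mem t ht =>
        obtain ⟨x, s, y, rfl⟩ := ht
        intro r
        rw [smul_sub, TensorProduct.smul_tmul', TensorProduct.smul_tmul', smul_comm r, map_sub,
          TensorProduct.liftAddHom_tmul, TensorProduct.liftAddHom_tmul, hβ, sub_self]
      | zero => simp
      | add a b _ _ ha hb =>
        intro r
        rw [smul_add, map_add, ha, hb, add_zero]
      | smul r t _ h =>
        intro r'
        rw [smul_smul, h]

/-- The adjunction isomorphism `(ω ⊗_S N)⁺ ≃ Hom_S(N, ω⁺)`. -/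
def tensDual : (Tens R S ω N →+ AddCircle (1 : ℚ)) ≃ (N →ₗ[S] CharDual ω) where
  toFun χ :=
    { toFun := fun y => ({
        toFun := fun x => χ (Tens.tmul R S ω x y)
        map_zero' := by
          have := Tens.smul_tmul R S ω 0 0 y
          rw [zero_smul, zero_smul] at this
          rw [this, map_zero]
        map_add' := fun x x' => by rw [Tens.add_tmul, map_add] } : ω →+ AddCircle (1 : ℚ))
      map_add' := fun y y' => CharDual.ext fun x =>
        (congrArg χ (Tens.tmul_add R S ω x y y')).trans (map_add χ _ _)
      map_smul' := fun s y => CharDual.ext fun x =>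
        congrArg χ (Tens.op_smul_tmul R S ω s x y).symm }
  invFun φ := Tens.liftAdd R S ω (AddMonoidHom.flip (φ.toAddMonoidHom : N →+ ω →+ _))
    fun x s y => (DFunLike.congr_fun (φ.map_smul s y) x).symm
  left_inv χ := Tens.addHom_ext R S ω fun _ _ => rfl
  right_inv φ := rfl

theorem tensDual_comp_map (χ : Tens R S ω N' →+ AddCircle (1 : ℚ)) (g : N →ₗ[S] N') :
    tensDual R S ω (χ.comp (Tens.map R S ω g).toAddMonoidHom) = tensDual R S ω χ ∘ₗ g := rfl

/-- `ω ⊗_S g` is injective if and only if homomorphisms to `ω⁺` extend along `g`. -/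
theorem Tens.map_injective_iff (g : N →ₗ[S] N') :
    Function.Injective (Tens.map R S ω g) ↔
      ∀ φ : N →ₗ[S] CharDual ω, ∃ ψ : N' →ₗ[S] CharDual ω, ψ ∘ₗ g = φ := by
  refine ⟨fun h φ => ?_, fun h => ?_⟩
  · obtain ⟨ψ, hψ⟩ := exists_character_extension (Tens.map R S ω g).toAddMonoidHom h
      ((tensDual R S ω).symm φ)
    exact ⟨tensDual R S ω ψ, by rw [← tensDual_comp_map, hψ, Equiv.apply_symm_apply]⟩
  · refine injective_of_characters_surjective (Tens.map R S ω g).toAddMonoidHom fun χ => ?_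
    obtain ⟨ψ, hψ⟩ := h (tensDual R S ω χ)
    obtain ⟨ψ, rfl⟩ := (tensDual R S ω).surjective ψ
    exact ⟨ψ, (tensDual R S ω).injective hψ⟩

/-- `Tor_i(ω, N) = 0` if and only if `Ext^i(N, ω⁺) = 0`. -/
theorem isZero_tor_iff (N : ModuleCat.{u} S) (i : ℕ) :
    Limits.IsZero (Tor R S ω (i + 1) N) ↔
      Subsingleton (Abelian.Ext N (ModuleCat.of S (CharDual ω)) (i + 1)) := by
  let P := projectiveResolution N
  let T := tensorFunctor R S ω
  have h1 : Limits.IsZero (Tor R S ω (i + 1) N) ↔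
      ∀ y : Tens R S ω (P.complex.X (i + 1)),
        Tens.map R S ω (P.complex.d (i + 1) i).hom y = 0 →
          ∃ x, Tens.map R S ω (P.complex.d (i + 2) (i + 1)).hom x = y := by
    rw [Tor, (P.isoLeftDerivedObj T (i + 1)).isZero_iff]
    change Limits.IsZero (((T.mapHomologicalComplex _).obj P.complex).homology (i + 1)) ↔ _
    rw [← HomologicalComplex.exactAt_iff_isZero_homology,
      HomologicalComplex.exactAt_iff' _ (i + 2) (i + 1) i (by simp) (by simp),
      ShortComplex.moduleCat_exact_iff]
    rfl
  rw [h1]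
  constructor
  · intro h
    refine subsingleton_of_forall_eq 0 fun α => ?_
    obtain ⟨f, hf, rfl⟩ := P.extMk_surjective α (i + 2) rfl
    rw [P.extMk_eq_zero_iff f (i + 2) rfl hf i rfl]
    obtain ⟨χ, hχ⟩ := (tensDual R S ω).surjective f.hom
    obtain ⟨ψ, hψ⟩ := exists_character_factor
      -- Exactness puts the kernel of the outgoing differential in the image of the incoming one,
      -- where `χ` vanishes by the cocycle condition. The factor of `χ` then exhibits `f` as a
      -- coboundary.
      (Tens.map R S ω (P.complex.d (i + 1) i).hom).toAddMonoidHom χ (by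
        intro y hy
        obtain ⟨x, rfl⟩ := h y hy
        have h0 : χ.comp (Tens.map R S ω (P.complex.d (i + 2) (i + 1)).hom).toAddMonoidHom = 0 := by
          apply (tensDual R S ω).injective
          rw [tensDual_comp_map, hχ]
          exact congrArg ModuleCat.Hom.hom hf
        exact DFunLike.congr_fun h0 x)
    refine ⟨ModuleCat.ofHom (tensDual R S ω ψ), ModuleCat.hom_ext ?_⟩
    rw [← hχ, ← hψ]
    rfl
  · intro h
    refine exact_of_characters
      (Tens.map R S ω (P.complex.d (i + 2) (i + 1)).hom).toAddMonoidHom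
      (Tens.map R S ω (P.complex.d (i + 1) i).hom).toAddMonoidHom fun χ hχ => ?_
    have hf : P.complex.d (i + 2) (i + 1) ≫
        (ModuleCat.ofHom (tensDual R S ω χ) : _ ⟶ ModuleCat.of S (CharDual ω)) = 0 :=
      ModuleCat.hom_ext (congrArg (tensDual R S ω) hχ)
    obtain ⟨g, hg⟩ := (P.extMk_eq_zero_iff _ (i + 2) rfl hf i rfl).1 (h.elim _ _)
    obtain ⟨ψ, hψ⟩ := (tensDual R S ω).surjective g.hom
    refine ⟨ψ, (tensDual R S ω).injective ?_⟩
    rw [tensDual_comp_map, hψ]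
    exact congrArg ModuleCat.Hom.hom hg

end TensorDual

/-! ### Injective envelopes and minimal copresentations -/

section InjectiveEnvelope

variable {A : Type u} [Ring A]

/-- A submodule `E` of `J` is essential over its submodule `M`. -/
def IsEssentialIn {J : Type u} [AddCommGroup J] [Module A J] (M E : Submodule A J) : Prop :=
  M ≤ E ∧ ∀ K ≤ E, K ⊓ M = ⊥ → K = ⊥

theorem exists_maximal_essential {J : Type u} [AddCommGroup J] [Module A J]
    (M : Submodule A J) : ∃ E, Maximal (IsEssentialIn M) E := by
  obtain ⟨E, -, hE⟩ := zorn_le_nonempty₀ {E | IsEssentialIn M E} (fun c hc hchain E₀ hE₀ => by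
    refine ⟨sSup c, ⟨(hc hE₀).1.trans (le_sSup hE₀), fun K hK hKM => ?_⟩, fun _ => le_sSup⟩
    rw [Submodule.eq_bot_iff]
    intro x hx
    obtain ⟨E, hE, hxE⟩ := (Submodule.mem_sSup_of_directed ⟨E₀, hE₀⟩ hchain.directedOn).1 (hK hx)
    -- A cyclic submodule lies in a single member of the chain, whose essentiality applies.
    have hspan : Submodule.span A {x} = ⊥ := by
      refine (hc hE).2 _ ((Submodule.span_singleton_le_iff_mem _ _).2 hxE) (le_bot_iff.1 ?_)
      exact (inf_le_inf_right M ((Submodule.span_singleton_le_iff_mem _ _).2 hx)).trans hKM.le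
    exact Submodule.span_singleton_eq_bot.1 hspan) M ⟨le_rfl, fun K hK h => by
      rwa [inf_eq_left.2 hK] at h⟩
  exact ⟨E, hE⟩

theorem exists_maximal_disjoint {J : Type u} [AddCommGroup J] [Module A J]
    (E : Submodule A J) : ∃ K, Maximal (fun K : Submodule A J => K ⊓ E = ⊥) K := by
  obtain ⟨K, -, hK⟩ := zorn_le_nonempty₀ {K : Submodule A J | K ⊓ E = ⊥}
    (fun c hc hchain K₀ hK₀ => by
      refine ⟨sSup c, ?_, fun _ => le_sSup⟩
      change sSup c ⊓ E = ⊥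
      rw [Submodule.eq_bot_iff]
      rintro x ⟨hx, hxE⟩
      obtain ⟨K, hK, hxK⟩ := (Submodule.mem_sSup_of_directed ⟨K₀, hK₀⟩ hchain.directedOn).1 hx
      have : x ∈ K ⊓ E := ⟨hxK, hxE⟩
      rwa [hc hK] at this) ⊥ (bot_inf_eq E)
  exact ⟨K, hK⟩

/-- A maximal essential extension inside an injective module is injective. -/
theorem injective_of_maximal_essential {J : Type u} [AddCommGroup J] [Module A J]
    (hJ : Module.Injective A J) {M E : Submodule A J} (hE : Maximal (IsEssentialIn M) E) :
    Module.Injective A E := by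
  obtain ⟨K, hK, hKmax⟩ := exists_maximal_disjoint E
  let j : E →ₗ[A] J ⧸ K := K.mkQ ∘ₗ E.subtype
  have hj : Function.Injective j := by
    refine (injective_iff_map_eq_zero j).2 fun x hx => ?_
    have : (x : J) ∈ K ⊓ E := ⟨(Submodule.Quotient.mk_eq_zero K).1 hx, x.2⟩
    rw [hK] at this
    exact Subtype.ext this
  -- The preimage of `L` contains `K` and still misses `E`, so maximality of `K` forces equality.
  have hjess : ∀ L : Submodule A (J ⧸ K), L ⊓ LinearMap.range j = ⊥ → L = ⊥ := by
    intro L hL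
    have h1 : L.comap K.mkQ ⊓ E = ⊥ := by
      rw [Submodule.eq_bot_iff]
      rintro x ⟨hx, hxE⟩
      have : K.mkQ x ∈ L ⊓ LinearMap.range j := ⟨hx, ⟨x, hxE⟩, rfl⟩
      rw [hL] at this
      exact congrArg Subtype.val (hj (this.trans (map_zero j).symm) : (⟨x, hxE⟩ : E) = 0)
    have h2 : L.comap K.mkQ ≤ K := hKmax h1 fun x hx => by
      simp [(Submodule.Quotient.mk_eq_zero K).2 hx]
    rw [Submodule.eq_bot_iff]
    intro y hy
    obtain ⟨x, rfl⟩ := K.mkQ_surjective y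
    exact (Submodule.Quotient.mk_eq_zero K).2 (h2 hy)
  obtain ⟨φ, hφ⟩ := hJ.out j hj E.subtype
  have hφinj : Function.Injective φ := by
    rw [← LinearMap.ker_eq_bot]
    refine hjess _ ?_
    rw [Submodule.eq_bot_iff]
    rintro _ ⟨hy, x, rfl⟩
    have : (x : J) = 0 := (hφ x).symm.trans hy
    rw [show x = 0 from Subtype.ext this, map_zero]
  have hEr : E ≤ LinearMap.range φ := fun x hx => ⟨j ⟨x, hx⟩, hφ ⟨x, hx⟩⟩
  -- The range of `φ` contains `E` and is again essential over `M`, so maximality of `E` applies.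
  have hrange : LinearMap.range φ ≤ E := by
    refine hE.2 ⟨hE.1.1.trans hEr, fun L hL hLM => ?_⟩ hEr
    have h1 : L ⊓ E = ⊥ := hE.1.2 _ inf_le_right (le_bot_iff.1 (by
      rw [inf_assoc]
      exact (inf_le_inf_left L inf_le_right).trans hLM.le))
    have h2 : L.comap φ = ⊥ := by
      refine hjess _ ?_
      rw [Submodule.eq_bot_iff]
      rintro _ ⟨hy, x, rfl⟩
      have : (x : J) ∈ L ⊓ E := ⟨by simpa [hφ] using hy, x.2⟩
      rw [h1] at this
      rw [show x = 0 from Subtype.ext this, map_zero]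
    rw [Submodule.eq_bot_iff]
    intro x hx
    obtain ⟨y, rfl⟩ := hL hx
    have : y ∈ L.comap φ := hx
    rw [h2] at this
    rw [(this : y = 0), map_zero]
  -- This retraction makes `E` a direct summand of the injective module `J`.
  let π : J →ₗ[A] E := (φ ∘ₗ K.mkQ).codRestrict E fun x => hrange ⟨_, rfl⟩
  have hπ : ∀ x : E, π x = x := fun x => Subtype.ext (hφ x)
  refine ⟨fun X Y _ _ _ _ f hf g => ?_⟩
  obtain ⟨h, hh⟩ := hJ.out f hf (E.subtype ∘ₗ g)
  exact ⟨π ∘ₗ h, fun x => by simp [hh, hπ]⟩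

/-- Every module has an injective envelope. -/
theorem exists_injective_envelope (M : Type u) [AddCommGroup M] [Module A M] :
    ∃ (E : ModuleCat.{u} A) (ε : M →ₗ[A] E), Injective E ∧ Function.Injective ε ∧
      IsEssential (LinearMap.range ε) := by
  let J := Injective.under (ModuleCat.of A M)
  let ι : M →ₗ[A] J := (Injective.ι (ModuleCat.of A M)).hom
  have hι : Function.Injective ι := (ModuleCat.mono_iff_injective _).1 inferInstance
  have hJ : Module.Injective A J := (Module.injective_iff_injective_object A J).2
    (inferInstanceAs (Injective J))
  obtain ⟨E, hE⟩ := exists_maximal_essential (LinearMap.range ι)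
  refine ⟨ModuleCat.of A E, ι.codRestrict E fun x => hE.1.1 ⟨x, rfl⟩,
    (Module.injective_iff_injective_object A E).1 (injective_of_maximal_essential hJ hE),
    fun x y hxy => hι (congrArg Subtype.val hxy), fun K hK => ?_⟩
  have : K.map E.subtype = ⊥ := by
    refine hE.1.2 _ (Submodule.map_subtype_le _ _) ?_
    rw [Submodule.eq_bot_iff]
    rintro _ ⟨⟨x, hx, rfl⟩, y, hy⟩
    have : x ∈ K ⊓ LinearMap.range (ι.codRestrict E fun x => hE.1.1 ⟨x, rfl⟩) :=
      ⟨hx, y, Subtype.ext hy⟩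
    rw [hK] at this
    rw [(this : x = 0), map_zero]
  exact Submodule.map_injective_of_injective E.injective_subtype
    (this.trans (Submodule.map_bot _).symm)

theorem nonempty_minimalInjectiveCopresentation (M : ModuleCat.{u} A) :
    Nonempty (MinimalInjectiveCopresentation M) := by
  obtain ⟨I₀, ε, h₀, hε, hess⟩ := exists_injective_envelope (A := A) M
  obtain ⟨I₁, j, h₁, hj, hess'⟩ := exists_injective_envelope (A := A) (I₀ ⧸ LinearMap.range ε)
  exact ⟨{
    I₀ := I₀
    I₁ := I₁
    ε := ModuleCat.ofHom ε
    f := ModuleCat.ofHom (j ∘ₗ (LinearMap.range ε).mkQ)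
    injective₀ := h₀
    injective₁ := h₁
    ε_injective := hε
    exact := fun x => by
      change j ((LinearMap.range ε).mkQ x) = 0 ↔ _
      rw [map_eq_zero_iff j hj]
      exact Submodule.Quotient.mk_eq_zero _
    essential₀ := hess
    essential₁ := by
      change IsEssential (LinearMap.range (j ∘ₗ (LinearMap.range ε).mkQ))
      rwa [LinearMap.range_comp, Submodule.range_mkQ, Submodule.map_top] }⟩

end InjectiveEnvelope

/-! ### Finitely generated syzygies and dual bases -/

section Syzygies

/-- `X` has a projective resolution whose terms of degree at most `n` are finitely generated. -/
def IsFP (A : Type u) [Ring A] : ℕ → ModuleCat.{u} A → Prop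
  | 0, X => Module.Finite A X
  | n + 1, X => ∃ (P X' : ModuleCat.{u} A) (a : X' →ₗ[A] P) (b : P →ₗ[A] X),
      Module.Projective A P ∧ Module.Finite A P ∧ Function.Injective a ∧ Function.Exact a b ∧
        Function.Surjective b ∧ IsFP A n X'

variable {A : Type u} [Ring A]

theorem IsFP.finite {n : ℕ} {X : ModuleCat.{u} A} (h : IsFP A n X) : Module.Finite A X := by
  cases n with
  | zero => exact h
  | succ n =>
    obtain ⟨P, X', a, b, -, hP, -, -, hb, -⟩ := h
    exact Module.Finite.of_surjective b hb

/-- The images of the differentials are the successive syzygies. Each induction step on `n` passes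
from one to the next, so `k` must vary. -/
theorem isFP_range {X : ModuleCat.{u} A} (P : ProjectiveResolution X)
    (hP : ∀ n, Module.Finite A (P.complex.X n)) (n k : ℕ) :
    IsFP A n (ModuleCat.of A (LinearMap.range (P.complex.d (k + 1) k).hom)) := by
  induction n generalizing k with
  | zero =>
    have := hP (k + 1)
    exact Module.Finite.range _
  | succ n ih =>
    refine ⟨P.complex.X (k + 1), _, (LinearMap.range (P.complex.d (k + 2) (k + 1)).hom).subtype,
      (P.complex.d (k + 1) k).hom.rangeRestrict,
      (IsProjective.iff_projective _).2 (P.projective _), hP _, Submodule.injective_subtype _, ?_,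
      LinearMap.surjective_rangeRestrict _, ih (k + 1)⟩
    rw [LinearMap.exact_iff, LinearMap.ker_rangeRestrict, Submodule.range_subtype]
    exact (P.exact_succ k).moduleCat_range_eq_ker.symm

theorem HasDegreewiseFiniteResolution.isFP {X : Type u} [AddCommGroup X] [Module A X]
    (h : HasDegreewiseFiniteResolution A X) (n : ℕ) : IsFP A (n + 1) (ModuleCat.of A X) := by
  obtain ⟨P, hP⟩ := h
  refine ⟨P.complex.X 0, _, (LinearMap.range (P.complex.d 1 0).hom).subtype, (P.π.f 0).hom,
      (IsProjective.iff_projective _).2 (P.projective _), hP _, Submodule.injective_subtype _, ?_,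
      (ModuleCat.epi_iff_surjective _).1 inferInstance, isFP_range P hP n 0⟩
  refine fun y =>
    ((ShortComplex.ShortExact.moduleCat_exact_iff_function_exact _).1 P.exact₀ y).trans ?_
  exact ⟨fun ⟨x, hx⟩ => ⟨⟨y, x, hx⟩, rfl⟩, fun ⟨z, hz⟩ => hz ▸ z.2⟩

theorem exists_dual_basis (P : Type u) [AddCommGroup P] [Module A P] [Module.Projective A P]
    [Module.Finite A P] : ∃ (n : ℕ) (p : Fin n → P) (φ : Fin n → P →ₗ[A] A),
      ∀ x, ∑ i, φ i x • p i = x := by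
  obtain ⟨n, b, hb⟩ := Module.Finite.exists_fin' A P
  obtain ⟨s, hs⟩ := Module.projective_lifting_property b LinearMap.id hb
  refine ⟨n, fun i => b (Pi.single i 1), fun i => LinearMap.proj i ∘ₗ s, fun x => ?_⟩
  conv_rhs => rw [← LinearMap.id_apply (R := A) x, ← hs, LinearMap.comp_apply,
    pi_eq_sum_univ' (s x), map_sum]
  refine Finset.sum_congr rfl fun i _ => ?_
  rw [map_smul]
  congr 2

end Syzygies

/-! ### Exactness and injectivity properties of character modules -/

section CharDualMap

variable {S : Type u} [Ring S] {X Y Z : Type u} [AddCommGroup X] [AddCommGroup Y] [AddCommGroup Z]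
  [Module Sᵐᵒᵖ X] [Module Sᵐᵒᵖ Y] [Module Sᵐᵒᵖ Z]

instance : AddMonoidHomClass (CharDual X) X (AddCircle (1 : ℚ)) :=
  inferInstanceAs (AddMonoidHomClass (X →+ AddCircle (1 : ℚ)) X (AddCircle (1 : ℚ)))

/-- The homomorphism `Y⁺ → X⁺` of left `S`-modules dual to a homomorphism of right modules. -/
def CharDual.map (a : X →ₗ[Sᵐᵒᵖ] Y) : CharDual Y →ₗ[S] CharDual X where
  toFun χ := AddMonoidHom.comp (χ : Y →+ AddCircle (1 : ℚ)) a.toAddMonoidHom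
  map_add' _ _ := rfl
  map_smul' s χ := CharDual.ext fun x => congrArg χ (a.map_smul (op s) x).symm

theorem CharDual.map_injective {a : X →ₗ[Sᵐᵒᵖ] Y} (ha : Function.Surjective a) :
    Function.Injective (CharDual.map a) := by
  intro χ ψ h
  refine CharDual.ext fun y => ?_
  obtain ⟨x, rfl⟩ := ha y
  exact DFunLike.congr_fun h x

theorem CharDual.map_surjective {a : X →ₗ[Sᵐᵒᵖ] Y} (ha : Function.Injective a) :
    Function.Surjective (CharDual.map a) :=
  fun χ => exists_character_extension a.toAddMonoidHom ha χ

theorem CharDual.map_exact {a : X →ₗ[Sᵐᵒᵖ] Y} {b : Y →ₗ[Sᵐᵒᵖ] Z} (h : Function.Exact a b) :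
    Function.Exact (CharDual.map b) (CharDual.map a) := by
  intro χ
  constructor
  · intro hχ
    refine exists_character_factor b.toAddMonoidHom χ fun y hy => ?_
    obtain ⟨x, rfl⟩ := (h y).1 hy
    exact DFunLike.congr_fun hχ x
  · rintro ⟨ψ, rfl⟩
    exact CharDual.ext fun x => (congrArg ψ (h.apply_apply_eq_zero x)).trans (map_zero ψ)

/-- The character module of a finitely generated projective right module is injective. -/
theorem CharDual.injective (P : Type u) [AddCommGroup P] [Module Sᵐᵒᵖ P]
    [Module.Projective Sᵐᵒᵖ P] [Module.Finite Sᵐᵒᵖ P] : Module.Injective S (CharDual P) := by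
  obtain ⟨n, p, φ, hφ⟩ := exists_dual_basis (A := Sᵐᵒᵖ) P
  refine ⟨fun B C _ _ _ _ j hj f => ?_⟩
  -- In a dual basis, `f b` is determined by its values at the `p i`. These depend additively on
  -- `b`, so they extend to `C`, and `G` reassembles the extensions `S`-linearly.
  have hg : ∀ i, ∃ g : C →+ AddCircle (1 : ℚ), ∀ b, g (j b) = f b (p i) := by
    intro i
    let fi : B →+ AddCircle (1 : ℚ) :=
      { toFun := fun b => f b (p i)
        map_zero' := by rw [map_zero]; rfl
        map_add' := fun b b' => by rw [map_add]; rfl }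
    obtain ⟨g, hg⟩ := exists_character_extension j.toAddMonoidHom hj fi
    exact ⟨g, fun b => DFunLike.congr_fun hg b⟩
  choose g hg using hg
  let G : C →ₗ[S] CharDual P :=
    { toFun := fun c => ({
        toFun := fun x => ∑ i, g i (unop (φ i x) • c)
        map_zero' := by simp
        map_add' := fun x y => by simp [add_smul, Finset.sum_add_distrib] } :
          P →+ AddCircle (1 : ℚ))
      map_add' := fun c c' => CharDual.ext fun x => by
        change ∑ i, g i (unop (φ i x) • (c + c')) =
          ∑ i, g i (unop (φ i x) • c) + ∑ i, g i (unop (φ i x) • c')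
        simp [Finset.sum_add_distrib]
      map_smul' := fun s c => CharDual.ext fun x => by
        change ∑ i, g i (unop (φ i x) • s • c) = ∑ i, g i (unop (φ i (op s • x)) • c)
        simp [smul_smul] }
  refine ⟨G, fun b => CharDual.ext fun x => ?_⟩
  change ∑ i, g i (unop (φ i x) • j b) = f b x
  conv_rhs => rw [← hφ x]
  refine Eq.trans ?_ (map_sum (f b) _ _).symm
  refine Finset.sum_congr rfl fun i _ => ?_
  rw [← map_smul, hg, map_smul]
  rfl

end CharDualMap

/-! ### Factorization through surjections and into injective modules -/

theorem exists_factor_of_surjective {A U V W : Type u} [Ring A] [AddCommGroup U] [Module A U]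
    [AddCommGroup V] [Module A V] [AddCommGroup W] [Module A W] {b : U →ₗ[A] V}
    (hb : Function.Surjective b) {g : U →ₗ[A] W} (h : LinearMap.ker b ≤ LinearMap.ker g) :
    ∃ k : V →ₗ[A] W, k ∘ₗ b = g := by
  refine ⟨(LinearMap.ker b).liftQ g h ∘ₗ (b.quotKerEquivOfSurjective hb).symm.toLinearMap,
    LinearMap.ext fun y => ?_⟩
  have : (b.quotKerEquivOfSurjective hb).symm (b y) = Submodule.Quotient.mk y := by
    rw [LinearEquiv.symm_apply_eq]
    rfl
  simp [this]

theorem exists_factor_of_injective {A I U V : Type u} [Ring A] [AddCommGroup I] [Module A I]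
    [AddCommGroup U] [Module A U] [AddCommGroup V] [Module A V] (hI : Module.Injective A I)
    (c : U →ₗ[A] V) (l : U →ₗ[A] I) (h : ∀ x, c x = 0 → l x = 0) :
    ∃ m : V →ₗ[A] I, m ∘ₗ c = l := by
  obtain ⟨m, hm⟩ := hI.out ((LinearMap.ker c).liftQ c le_rfl)
    (LinearMap.ker_eq_bot.1 (Submodule.ker_liftQ_eq_bot _ _ _ le_rfl))
    ((LinearMap.ker c).liftQ l fun x hx => h x hx)
  exact ⟨m, LinearMap.ext fun x => hm (Submodule.Quotient.mk x)⟩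

/-! ### The evaluation map into `Hom_R(Hom(X, ω), I)` and its dual -/

section DoubleHom

variable {R S ω : Type u} [Ring R] [Ring S] [AddCommGroup ω] [Module R ω] [Module Sᵐᵒᵖ ω]
variable [SMulCommClass Sᵐᵒᵖ R ω]
variable {I : Type u} [AddCommGroup I] [Module R I]
variable {X Y Z : Type u} [AddCommGroup X] [AddCommGroup Y] [AddCommGroup Z]
  [Module Sᵐᵒᵖ X] [Module Sᵐᵒᵖ Y] [Module Sᵐᵒᵖ Z]

variable (R ω) in
/-- Precomposition with `a : X → Y`, as an `R`-linear map `Hom(Y, ω) → Hom(X, ω)`. -/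
def precomp (a : X →ₗ[Sᵐᵒᵖ] Y) : (Y →ₗ[Sᵐᵒᵖ] ω) →ₗ[R] (X →ₗ[Sᵐᵒᵖ] ω) where
  toFun g := g ∘ₗ a
  map_add' _ _ := rfl
  map_smul' _ _ := rfl

variable (R ω I) in
/-- The homomorphism `Hom_R(Hom(X, ω), I) → Hom_R(Hom(Y, ω), I)` induced by `a : X → Y`. -/
def doubleHomMap (a : X →ₗ[Sᵐᵒᵖ] Y) :
    ((X →ₗ[Sᵐᵒᵖ] ω) →ₗ[R] I) →+ ((Y →ₗ[Sᵐᵒᵖ] ω) →ₗ[R] I) where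
  toFun h := h ∘ₗ precomp R ω a
  map_zero' := rfl
  map_add' _ _ := rfl

theorem doubleHomMap_surjective (hI : Module.Injective R I) {b : X →ₗ[Sᵐᵒᵖ] Y}
    (hb : Function.Surjective b) : Function.Surjective (doubleHomMap R ω I b) := by
  intro k
  refine exists_factor_of_injective hI (precomp R ω b) k fun g hg => ?_
  have : g = 0 := LinearMap.ext fun y => by
    obtain ⟨x, rfl⟩ := hb y
    exact DFunLike.congr_fun hg x
  rw [this, map_zero]

/-- `Hom(-, ω)` is left exact and `Hom_R(-, I)` is exact, so the double Hom is right exact in `X`,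
just like `X ⊗_S Hom_R(ω, I)`. -/
theorem doubleHomMap_exact (hI : Module.Injective R I) {a : X →ₗ[Sᵐᵒᵖ] Y} {b : Y →ₗ[Sᵐᵒᵖ] Z}
    (hab : Function.Exact a b) (hb : Function.Surjective b) (l : (Y →ₗ[Sᵐᵒᵖ] ω) →ₗ[R] I)
    (hl : doubleHomMap R ω I b l = 0) : ∃ m, doubleHomMap R ω I a m = l := by
  refine exists_factor_of_injective hI (precomp R ω a) l fun g hg => ?_
  have hker : LinearMap.ker b ≤ LinearMap.ker g := by
    intro y hy
    obtain ⟨x, rfl⟩ := (hab y).1 hy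
    exact DFunLike.congr_fun hg x
  obtain ⟨k, hk⟩ := exists_factor_of_surjective hb hker
  rw [← hk]
  exact DFunLike.congr_fun hl k

variable [SMulCommClass R Sᵐᵒᵖ ω]

/-- The evaluation `g ↦ f (g x)`. -/
def doubleEval (x : X) (f : RHom R ω I) : (X →ₗ[Sᵐᵒᵖ] ω) →ₗ[R] I where
  toFun g := f (g x)
  map_add' g g' := LinearMap.map_add (f : ω →ₗ[R] I) (g x) (g' x)
  map_smul' r g := LinearMap.map_smul (f : ω →ₗ[R] I) r (g x)

/-- The homomorphism `Hom_R(Hom(X, ω), I)⁺ → Hom_S(Hom_R(ω, I), X⁺)` dual to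
`X ⊗_S Hom_R(ω, I) → Hom_R(Hom(X, ω), I)`. -/
def evalDual (χ : ((X →ₗ[Sᵐᵒᵖ] ω) →ₗ[R] I) →+ AddCircle (1 : ℚ)) :
    RHom R ω I →ₗ[S] CharDual X where
  toFun f := ({
    toFun := fun x => χ (doubleEval x f)
    map_zero' := by
      convert map_zero χ
      ext g
      exact (congrArg f (map_zero g)).trans (LinearMap.map_zero (f : ω →ₗ[R] I))
    map_add' := fun x y => by
      rw [← map_add]
      congr 1
      ext g
      exact (congrArg f (map_add g x y)).trans (LinearMap.map_add (f : ω →ₗ[R] I) _ _) } :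
    X →+ AddCircle (1 : ℚ))
  map_add' f f' := CharDual.ext fun x => map_add χ (doubleEval x f) (doubleEval x f')
  map_smul' s f := CharDual.ext fun x => congrArg χ <| LinearMap.ext fun g =>
    congrArg f (g.map_smul (op s) x).symm

theorem evalDual_apply (χ : ((X →ₗ[Sᵐᵒᵖ] ω) →ₗ[R] I) →+ AddCircle (1 : ℚ)) (f : RHom R ω I)
    (x : X) : evalDual (S := S) χ f x = χ (doubleEval x f) := rfl

theorem evalDual_comp (a : X →ₗ[Sᵐᵒᵖ] Y)
    (χ : ((Y →ₗ[Sᵐᵒᵖ] ω) →ₗ[R] I) →+ AddCircle (1 : ℚ)) :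
    evalDual (χ.comp (doubleHomMap R ω I a)) = CharDual.map a ∘ₗ evalDual χ := rfl

section Projective

variable {n : ℕ} (p : Fin n → X) (φ : Fin n → X →ₗ[Sᵐᵒᵖ] Sᵐᵒᵖ)

/-- The homomorphism `w ↦ h (x ↦ φ x • w)`. -/
def doubleCoord (φ : X →ₗ[Sᵐᵒᵖ] Sᵐᵒᵖ) : ((X →ₗ[Sᵐᵒᵖ] ω) →ₗ[R] I) →+ RHom R ω I where
  toFun h := h ∘ₗ ({
    toFun := fun w => φ.smulRight w
    map_add' := fun _ _ => LinearMap.ext fun _ => smul_add _ _ _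
    map_smul' := fun r w => LinearMap.ext fun x => (smul_comm r (φ x) w).symm } :
      ω →ₗ[R] (X →ₗ[Sᵐᵒᵖ] ω))
  map_zero' := rfl
  map_add' _ _ := rfl

theorem doubleCoord_doubleEval (φ : X →ₗ[Sᵐᵒᵖ] Sᵐᵒᵖ) (x : X) (f : RHom R ω I) :
    doubleCoord φ (doubleEval x f) = unop (φ x) • f := rfl

/-- A dual basis of `X` writes every `h` as a sum of evaluations, giving an explicit inverse of the
evaluation map. -/
theorem sum_doubleEval_doubleCoord (hφ : ∀ x, ∑ i, φ i x • p i = x)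
    (h : (X →ₗ[Sᵐᵒᵖ] ω) →ₗ[R] I) : ∑ i, doubleEval (p i) (doubleCoord (φ i) h) = h := by
  ext g
  rw [LinearMap.sum_apply]
  change ∑ i, h ((φ i).smulRight (g (p i))) = h g
  rw [← map_sum]
  congr 1
  ext x
  conv_rhs => rw [← hφ x]
  simp

theorem evalDual_injective_of_projective [Module.Projective Sᵐᵒᵖ X] [Module.Finite Sᵐᵒᵖ X]
    (χ : ((X →ₗ[Sᵐᵒᵖ] ω) →ₗ[R] I) →+ AddCircle (1 : ℚ)) (hχ : evalDual χ = 0) : χ = 0 := by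
  obtain ⟨n, p, φ, hφ⟩ := exists_dual_basis (A := Sᵐᵒᵖ) X
  ext h
  rw [← sum_doubleEval_doubleCoord p φ hφ h, map_sum]
  refine Finset.sum_eq_zero fun i _ => ?_
  rw [← evalDual_apply (S := S), hχ]
  rfl

theorem evalDual_surjective_of_projective [Module.Projective Sᵐᵒᵖ X] [Module.Finite Sᵐᵒᵖ X]
    (β : RHom R ω I →ₗ[S] CharDual X) :
    ∃ χ : ((X →ₗ[Sᵐᵒᵖ] ω) →ₗ[R] I) →+ AddCircle (1 : ℚ), evalDual χ = β := by
  obtain ⟨n, p, φ, hφ⟩ := exists_dual_basis (A := Sᵐᵒᵖ) X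
  let χ : ((X →ₗ[Sᵐᵒᵖ] ω) →ₗ[R] I) →+ AddCircle (1 : ℚ) :=
    ∑ i, ((AddMonoidHom.eval (p i)).comp
      (β.toAddMonoidHom : RHom R ω I →+ (X →+ AddCircle (1 : ℚ)))).comp (doubleCoord (φ i))
  refine ⟨χ, LinearMap.ext fun f => CharDual.ext fun x => ?_⟩
  rw [evalDual_apply, AddMonoidHom.finsetSum_apply]
  change ∑ i, β (doubleCoord (φ i) (doubleEval x f)) (p i) = β f x
  conv_rhs => rw [← hφ x]
  refine Eq.trans ?_ (map_sum (β f) _ _).symm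
  refine Finset.sum_congr rfl fun i _ => ?_
  rw [doubleCoord_doubleEval, map_smul]
  rfl

end Projective

/-- Dual form of surjectivity of the evaluation map: a finite free cover of `X` reduces it to the
projective case. -/
theorem evalDual_injective (hI : Module.Injective R I) [Module.Finite Sᵐᵒᵖ X]
    (χ : ((X →ₗ[Sᵐᵒᵖ] ω) →ₗ[R] I) →+ AddCircle (1 : ℚ)) (hχ : evalDual χ = 0) : χ = 0 := by
  obtain ⟨n, b, hb⟩ := Module.Finite.exists_fin' Sᵐᵒᵖ X
  have h0 : χ.comp (doubleHomMap R ω I b) = 0 :=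
    evalDual_injective_of_projective _ (by
      rw [evalDual_comp, hχ, LinearMap.comp_zero])
  ext h
  obtain ⟨k, rfl⟩ := doubleHomMap_surjective hI hb h
  exact DFunLike.congr_fun h0 k

/-- Dual form of injectivity of the evaluation map for finitely presented `Z`. This is a five lemma
argument: the projective `Y` supplies a character, and injectivity for `X` makes it descend to `Z`.
-/
theorem evalDual_surjective (hI : Module.Injective R I) [Module.Projective Sᵐᵒᵖ Y]
    [Module.Finite Sᵐᵒᵖ Y] [Module.Finite Sᵐᵒᵖ X] {a : X →ₗ[Sᵐᵒᵖ] Y} {b : Y →ₗ[Sᵐᵒᵖ] Z}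
    (hab : Function.Exact a b) (hb : Function.Surjective b)
    (β : RHom R ω I →ₗ[S] CharDual Z) :
    ∃ χ : ((Z →ₗ[Sᵐᵒᵖ] ω) →ₗ[R] I) →+ AddCircle (1 : ℚ), evalDual χ = β := by
  obtain ⟨χ, hχ⟩ := evalDual_surjective_of_projective (CharDual.map b ∘ₗ β)
  have h0 : χ.comp (doubleHomMap R ω I a) = 0 := by
    refine evalDual_injective hI _ ?_
    rw [evalDual_comp, hχ, ← LinearMap.comp_assoc,
      (CharDual.map_exact hab).linearMap_comp_eq_zero, LinearMap.zero_comp]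
  obtain ⟨ψ, hψ⟩ := exists_character_factor (doubleHomMap R ω I b) χ (by
    intro l hl
    obtain ⟨m, rfl⟩ := doubleHomMap_exact hI hab hb l hl
    exact DFunLike.congr_fun h0 m)
  refine ⟨ψ, LinearMap.ext fun f => CharDual.map_injective hb ?_⟩
  exact DFunLike.congr_fun ((evalDual_comp b ψ).symm.trans ((congrArg evalDual hψ).trans hχ)) f

theorem IsFP.evalDual_surjective (hI : Module.Injective R I) {n : ℕ} {X : ModuleCat.{u} Sᵐᵒᵖ}
    (hX : IsFP Sᵐᵒᵖ (n + 1) X) (β : RHom R ω I →ₗ[S] CharDual X) :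
    ∃ χ : ((X →ₗ[Sᵐᵒᵖ] ω) →ₗ[R] I) →+ AddCircle (1 : ℚ), evalDual χ = β := by
  obtain ⟨P, X', a, b, _, _, -, hab, hb, hX'⟩ := hX
  have := hX'.finite
  exact Semidualizing.evalDual_surjective hI hab hb β

/-- `Ext^i(Hom_R(ω, I), X⁺) = 0` if `I` is injective and `Ext^j(X, ω) = 0` for `j ≥ 1`. -/
theorem IsFP.subsingleton_ext_charDual (hI : Module.Injective R I) (i : ℕ)
    (X : ModuleCat.{u} Sᵐᵒᵖ) (hX : IsFP Sᵐᵒᵖ (i + 2) X)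
    (hext : ∀ j : ℕ, 1 ≤ j → Subsingleton (Abelian.Ext X (ModuleCat.of Sᵐᵒᵖ ω) j)) :
    Subsingleton (Abelian.Ext (ModuleCat.of S (RHom R ω I)) (ModuleCat.of S (CharDual X))
      (i + 1)) := by
  induction i generalizing X with
  | zero =>
    obtain ⟨P, X', a, b, _, _, ha, hab, hb, hX'⟩ := hX
    refine subsingleton_ext_one_of_exists_lift (CharDual.map_injective hb)
      (CharDual.map_exact hab) (CharDual.map_surjective ha) (CharDual.injective P) fun β => ?_
    obtain ⟨χ, rfl⟩ := hX'.evalDual_surjective hI β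
    -- `Ext¹(X, ω) = 0` makes `Hom(P, ω) → Hom(X', ω)` surjective, so the double Hom map is
    -- injective and `χ` extends. The extension provides the lift of `β` to `P⁺`.
    obtain ⟨ψ, rfl⟩ := exists_character_extension (doubleHomMap R ω I a) (by
      refine (injective_iff_map_eq_zero _).2 fun h hh => LinearMap.ext fun g => ?_
      obtain ⟨k, rfl⟩ := exists_extension_of_subsingleton_ext ha hab hb (hext 1 le_rfl) g
      exact DFunLike.congr_fun hh k) χ
    exact ⟨evalDual ψ, rfl⟩
  | succ i ih =>
    obtain ⟨P, X', a, b, hP, _, ha, hab, hb, hX'⟩ := hX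
    refine subsingleton_ext_succ_of_trd (CharDual.map_injective hb)
      (CharDual.map_exact hab) (CharDual.map_surjective ha) _ (CharDual.injective P)
      (ih X' hX' fun j hj => ?_)
    have : Projective (ModuleCat.of Sᵐᵒᵖ P) := (IsProjective.iff_projective _).1 hP
    obtain ⟨j, rfl⟩ := Nat.exists_eq_add_of_le' hj
    -- The syzygy `X'` inherits the vanishing of `Ext` into `ω` from one degree higher for `X`.
    exact subsingleton_ext_of_trd ha hab hb _
      (Abelian.Ext.subsingleton_of_projective (ModuleCat.of Sᵐᵒᵖ P) _ j) (hext _ (by omega))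

end DoubleHom

/-! ### The counit `θ` and the triangle identities -/

section Counit

variable (R S ω : Type u) [Ring R] [Ring S] [AddCommGroup ω] [Module R ω] [Module Sᵐᵒᵖ ω]
variable {N N' N'' : Type u} [AddCommGroup N] [Module S N] [AddCommGroup N'] [Module S N']
  [AddCommGroup N''] [Module S N'']

theorem Tens.map_comp_apply (a : N →ₗ[S] N') (b : N' →ₗ[S] N'') (t : Tens R S ω N) :
    Tens.map R S ω b (Tens.map R S ω a t) = Tens.map R S ω (b ∘ₗ a) t :=
  DFunLike.congr_fun (Tens.hom_ext R S ω (f := Tens.map R S ω b ∘ₗ Tens.map R S ω a)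
    (g := Tens.map R S ω (b ∘ₗ a)) fun _ _ => rfl) t

theorem Tens.map_surjective {b : N →ₗ[S] N'} (hb : Function.Surjective b) :
    Function.Surjective (Tens.map R S ω b) := by
  intro t
  induction t using Tens.induction with
  | tmul x y =>
    obtain ⟨y, rfl⟩ := hb y
    exact ⟨Tens.tmul R S ω x y, rfl⟩
  | add s t hs ht =>
    obtain ⟨s, rfl⟩ := hs
    obtain ⟨t, rfl⟩ := ht
    exact ⟨s + t, map_add _ _ _⟩

variable [SMulCommClass R Sᵐᵒᵖ ω]

/-- Right exactness of `ω ⊗_S -`, obtained from left exactness of `Hom_S(-, ω⁺)` by character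
duality. -/
theorem Tens.map_exact {a : N →ₗ[S] N'} {b : N' →ₗ[S] N''} (hab : Function.Exact a b)
    (hb : Function.Surjective b) (t : Tens R S ω N') (ht : Tens.map R S ω b t = 0) :
    ∃ s, Tens.map R S ω a s = t := by
  refine exact_of_characters (Tens.map R S ω a).toAddMonoidHom
    (Tens.map R S ω b).toAddMonoidHom (fun χ hχ => ?_) t ht
  have h0 : tensDual R S ω χ ∘ₗ a = 0 := by
    rw [← tensDual_comp_map, hχ]
    rfl
  have hker : LinearMap.ker b ≤ LinearMap.ker (tensDual R S ω χ) := by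
    intro y hy
    obtain ⟨x, rfl⟩ := (hab y).1 hy
    exact DFunLike.congr_fun h0 x
  obtain ⟨k, hk⟩ : ∃ k : N'' →ₗ[S] CharDual ω, k ∘ₗ b = tensDual R S ω χ :=
    exists_factor_of_surjective hb hker
  refine ⟨(tensDual R S ω).symm k, (tensDual R S ω).injective ?_⟩
  rw [tensDual_comp_map, Equiv.apply_symm_apply, hk]

variable (M : Type u) [AddCommGroup M] [Module R M]

/-- The canonical homomorphism `θ_M : ω ⊗_S Hom_R(ω, M) → M`, as a map of abelian groups. -/
def θAdd : Tens R S ω (RHom R ω M) →+ M :=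
  Tens.liftAdd R S ω (N := RHom R ω M) (AddMonoidHom.flip
    ({ toFun := fun f => LinearMap.toAddMonoidHom (f : ω →ₗ[R] M)
       map_zero' := rfl
       map_add' := fun _ _ => rfl } : RHom R ω M →+ ω →+ M)) fun _ _ _ => rfl

/-- The canonical homomorphism `θ_M : ω ⊗_S Hom_R(ω, M) → M`, `θ_M(x ⊗ f) = f x`. -/
def θ : Tens R S ω (RHom R ω M) →ₗ[R] M where
  toFun := θAdd R S ω M
  map_add' := map_add _
  map_smul' r t := by
    induction t using Tens.induction with
    | tmul x f => exact LinearMap.map_smul (f : ω →ₗ[R] M) r x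
    | add s t hs ht => rw [smul_add, map_add, hs, ht, map_add, smul_add]

variable {M}

theorem θ_naturality {M' : Type u} [AddCommGroup M'] [Module R M'] (g : M →ₗ[R] M')
    (t : Tens R S ω (RHom R ω M)) :
    θ R S ω M' (Tens.map R S ω (RHom.map S g) t) = g (θ R S ω M t) :=
  DFunLike.congr_fun (Tens.hom_ext R S ω (f := θ R S ω M' ∘ₗ Tens.map R S ω (RHom.map S g))
    (g := g ∘ₗ θ R S ω M) fun _ _ => rfl) t

theorem map_θ_μ (f : RHom R ω M) : RHom.map S (θ R S ω M) (μ R S ω (RHom R ω M) f) = f := rfl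

theorem θ_map_μ (t : Tens R S ω N) : θ R S ω (Tens R S ω N) (Tens.map R S ω (μ R S ω N) t) = t :=
  DFunLike.congr_fun (Tens.hom_ext R S ω
    (f := θ R S ω (Tens R S ω N) ∘ₗ Tens.map R S ω (μ R S ω N))
    (g := LinearMap.id) fun _ _ => rfl) t

theorem θ_bijective_of_isAdstatic (hN : Function.Bijective (μ R S ω N)) :
    Function.Bijective (θ R S ω (Tens R S ω N)) := by
  have hsurj : Function.Surjective (Tens.map R S ω (μ R S ω N)) := Tens.map_surjective R S ω hN.2
  refine ⟨fun s t hst => ?_, fun t => ⟨_, θ_map_μ R S ω t⟩⟩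
  obtain ⟨s, rfl⟩ := hsurj s
  obtain ⟨t, rfl⟩ := hsurj t
  rw [θ_map_μ, θ_map_μ] at hst
  rw [hst]

/-- By a triangle identity, `Hom_R(ω, θ_M)` is a left inverse of `μ`; it is injective because `θ_M`
is. -/
theorem μ_bijective_of_θ_bijective (hM : Function.Bijective (θ R S ω M)) :
    Function.Bijective (μ R S ω (RHom R ω M)) := by
  refine ⟨fun f g h => ?_, fun k => ⟨RHom.map S (θ R S ω M) k, ?_⟩⟩
  · rw [← map_θ_μ R S ω f, h, map_θ_μ]
  · refine RHom.ext fun x => hM.1 ?_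
    exact RHom.ext_iff.1 (map_θ_μ R S ω (RHom.map S (θ R S ω M) k)) x

end Counit

/-! ### Injective modules: `θ` is bijective and higher `Ext` vanishes -/

section InjectiveModules

variable {R S ω : Type u} [Ring R] [Ring S] [AddCommGroup ω] [Module R ω] [Module Sᵐᵒᵖ ω]
variable [SMulCommClass R Sᵐᵒᵖ ω] {I : Type u} [AddCommGroup I] [Module R I]

theorem IsSemidualizing.subsingleton_ext_rhom (hω : IsSemidualizing R S ω)
    (hI : Module.Injective R I) (i : ℕ) :
    Subsingleton (Abelian.Ext (ModuleCat.of S (RHom R ω I)) (ModuleCat.of S (CharDual ω))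
      (i + 1)) :=
  have : SMulCommClass Sᵐᵒᵖ R ω := SMulCommClass.symm _ _ _
  IsFP.subsingleton_ext_charDual hI i (ModuleCat.of Sᵐᵒᵖ ω) (hω.finite_right.isFP (i + 1))
    hω.ext_right

/-- For `X = ω` the target of evaluation is `Hom_R(Hom(ω, ω), I) ≅ Hom_R(R, I) ≅ I` by the left
homothety isomorphism, and evaluation becomes `θ_I`. -/
theorem IsSemidualizing.θ_bijective (hω : IsSemidualizing R S ω) (hI : Module.Injective R I) :
    Function.Bijective (θ R S ω I) := by
  have : SMulCommClass Sᵐᵒᵖ R ω := SMulCommClass.symm _ _ _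
  have hfp : IsFP Sᵐᵒᵖ 1 (ModuleCat.of Sᵐᵒᵖ ω) := hω.finite_right.isFP 0
  have : Module.Finite Sᵐᵒᵖ ω := hfp.finite
  let e : ((ω →ₗ[Sᵐᵒᵖ] ω) →ₗ[R] I) →+ I :=
    { toFun := fun h => h LinearMap.id
      map_zero' := rfl
      map_add' := fun _ _ => rfl }
  let ρ : R →ₗ[R] (ω →ₗ[Sᵐᵒᵖ] ω) :=
    { toFun := fun r => leftHomothety S ω r
      map_add' := fun r r' => LinearMap.ext fun x => add_smul r r' x
      map_smul' := fun r r' => LinearMap.ext fun x => mul_smul r r' x }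
  have hρ : ρ 1 = LinearMap.id := LinearMap.ext fun x => one_smul R x
  let ρ' : R ≃ₗ[R] (ω →ₗ[Sᵐᵒᵖ] ω) := LinearEquiv.ofBijective ρ hω.homothety_left
  have heval : ∀ χ : I →+ AddCircle (1 : ℚ),
      evalDual (S := S) (χ.comp e) = tensDual R S ω (χ.comp (θ R S ω I).toAddMonoidHom) :=
    fun χ => rfl
  constructor
  · refine injective_of_characters_surjective (θ R S ω I).toAddMonoidHom fun χ => ?_
    obtain ⟨ψ, hψ⟩ := hfp.evalDual_surjective hI (tensDual R S ω χ)
    obtain ⟨ψ', rfl⟩ := exists_character_factor e ψ (by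
      intro h hh
      have : h = 0 := LinearMap.ext fun g => by
        obtain ⟨r, rfl⟩ := ρ'.surjective g
        rw [← mul_one r, ← smul_eq_mul, map_smul, map_smul]
        exact (congrArg (fun g => r • h g) hρ).trans ((congrArg (r • ·) hh).trans (smul_zero r))
      rw [this, map_zero])
    exact ⟨ψ', (tensDual R S ω).injective hψ⟩
  · refine surjective_of_characters_injective (θ R S ω I).toAddMonoidHom fun χ hχ => ?_
    have h0 : χ.comp e = 0 := evalDual_injective (S := S) hI _ (by
      rw [heval, hχ]
      rfl)
    ext m
    -- The map sending the homothety of `r` to `r • m` takes the value `m` at the identity.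
    refine Eq.trans ?_
      (DFunLike.congr_fun h0 (LinearMap.toSpanSingleton R I m ∘ₗ ρ'.symm.toLinearMap))
    refine congrArg χ ?_
    change m = ρ'.symm LinearMap.id • m
    rw [← hρ, show ρ'.symm (ρ 1) = 1 from ρ'.symm_apply_apply 1, one_smul]

end InjectiveModules

/-! ### Characterization of `cT` and exchange of the two classes -/

section Cotorsionfree

variable {R S ω : Type u} [Ring R] [Ring S] [AddCommGroup ω] [Module R ω] [Module Sᵐᵒᵖ ω]
variable [SMulCommClass R Sᵐᵒᵖ ω]

theorem RHom.map_injective {M M' : Type u} [AddCommGroup M] [Module R M] [AddCommGroup M']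
    [Module R M'] {g : M →ₗ[R] M'} (hg : Function.Injective g) :
    Function.Injective (RHom.map (ω := ω) S g) :=
  fun _ _ h => RHom.ext fun x => hg (RHom.ext_iff.1 h x)

theorem RHom.map_exact {M M' M'' : Type u} [AddCommGroup M] [Module R M] [AddCommGroup M']
    [Module R M'] [AddCommGroup M''] [Module R M''] {f : M →ₗ[R] M'} {g : M' →ₗ[R] M''}
    (hf : Function.Injective f) (hfg : Function.Exact f g) :
    Function.Exact (RHom.map (ω := ω) S f) (RHom.map (ω := ω) S g) := by
  intro k
  constructor
  · intro hk
    have hmem : ∀ x, k x ∈ LinearMap.range f := fun x => (hfg _).1 (RHom.ext_iff.1 hk x)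
    refine ⟨(LinearEquiv.ofInjective f hf).symm.toLinearMap ∘ₗ
      LinearMap.codRestrict (LinearMap.range f) (k : ω →ₗ[R] M') hmem, RHom.ext fun x => ?_⟩
    exact congrArg Subtype.val ((LinearEquiv.ofInjective f hf).apply_symm_apply ⟨k x, hmem x⟩)
  · rintro ⟨k, rfl⟩
    exact RHom.ext fun x => hfg.apply_apply_eq_zero (k x)

section Copresentation

variable {M : ModuleCat.{u} R} (P : MinimalInjectiveCopresentation M)

variable (S ω) in
/-- The image of `Hom_R(ω, I⁰) → Hom_R(ω, I¹)`. -/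
abbrev homImage : Submodule S (RHom R ω P.I₁) := LinearMap.range (RHom.map (ω := ω) S P.f.hom)

theorem exact_homImage :
    Function.Exact (RHom.map (ω := ω) S P.ε.hom)
      (RHom.map (ω := ω) S P.f.hom).rangeRestrict := by
  intro k
  rw [← RHom.map_exact (ω := ω) (S := S) P.ε_injective P.exact k]
  exact Subtype.ext_iff

theorem exact_cotranspose :
    Function.Exact (homImage S ω P).subtype (homImage S ω P).mkQ := by
  rw [LinearMap.exact_iff, Submodule.ker_mkQ, Submodule.range_subtype]

variable (hω : IsSemidualizing R S ω)

include hω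

theorem subsingleton_ext_I₀ (i : ℕ) :
    Subsingleton (Abelian.Ext (ModuleCat.of S (RHom R ω P.I₀)) (ModuleCat.of S (CharDual ω))
      (i + 1)) :=
  hω.subsingleton_ext_rhom ((Module.injective_iff_injective_object R P.I₀).2 P.injective₀) i

theorem subsingleton_ext_I₁ (i : ℕ) :
    Subsingleton (Abelian.Ext (ModuleCat.of S (RHom R ω P.I₁)) (ModuleCat.of S (CharDual ω))
      (i + 1)) :=
  hω.subsingleton_ext_rhom ((Module.injective_iff_injective_object R P.I₁).2 P.injective₁) i

theorem θ_bijective_I₀ : Function.Bijective (θ R S ω P.I₀) :=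
  hω.θ_bijective ((Module.injective_iff_injective_object R P.I₀).2 P.injective₀)

theorem θ_bijective_I₁ : Function.Bijective (θ R S ω P.I₁) :=
  hω.θ_bijective ((Module.injective_iff_injective_object R P.I₁).2 P.injective₁)

theorem subsingleton_ext_cotranspose_succ (i : ℕ) :
    Subsingleton (Abelian.Ext (cotranspose S ω P) (ModuleCat.of S (CharDual ω)) (i + 2)) ↔
      Subsingleton (Abelian.Ext (ModuleCat.of S (homImage S ω P)) (ModuleCat.of S (CharDual ω))
        (i + 1)) :=
  ⟨subsingleton_ext_of_trd (Submodule.injective_subtype _) (exact_cotranspose P)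
    (Submodule.mkQ_surjective _) _ (subsingleton_ext_I₁ P hω i),
  subsingleton_ext_succ_of_fst (Submodule.injective_subtype _) (exact_cotranspose P)
    (Submodule.mkQ_surjective _) _ (subsingleton_ext_I₁ P hω (i + 1))⟩

theorem subsingleton_ext_homImage_succ (i : ℕ) :
    Subsingleton (Abelian.Ext (ModuleCat.of S (homImage S ω P)) (ModuleCat.of S (CharDual ω))
        (i + 2)) ↔
      Subsingleton (Abelian.Ext (ModuleCat.of S (RHom R ω M)) (ModuleCat.of S (CharDual ω))
        (i + 1)) :=
  ⟨subsingleton_ext_of_trd (RHom.map_injective P.ε_injective) (exact_homImage P)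
    (LinearMap.surjective_rangeRestrict _) _ (subsingleton_ext_I₀ P hω i),
  subsingleton_ext_succ_of_fst (RHom.map_injective P.ε_injective) (exact_homImage P)
    (LinearMap.surjective_rangeRestrict _) _ (subsingleton_ext_I₀ P hω (i + 1))⟩

theorem subsingleton_ext_cotranspose_one :
    Subsingleton (Abelian.Ext (cotranspose S ω P) (ModuleCat.of S (CharDual ω)) 1) ↔
      Function.Injective (Tens.map R S ω (homImage S ω P).subtype) := by
  rw [Tens.map_injective_iff]
  exact ⟨exists_extension_of_subsingleton_ext (Submodule.injective_subtype _)
      (exact_cotranspose P) (Submodule.mkQ_surjective _),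
    subsingleton_ext_one_of_exists_extension (Submodule.injective_subtype _)
      (exact_cotranspose P) (Submodule.mkQ_surjective _) (subsingleton_ext_I₁ P hω 0)⟩

theorem subsingleton_ext_homImage_one :
    Subsingleton (Abelian.Ext (ModuleCat.of S (homImage S ω P)) (ModuleCat.of S (CharDual ω)) 1) ↔
      Function.Injective (Tens.map R S ω (RHom.map (ω := ω) S P.ε.hom)) := by
  rw [Tens.map_injective_iff]
  exact ⟨exists_extension_of_subsingleton_ext (RHom.map_injective P.ε_injective)
      (exact_homImage P) (LinearMap.surjective_rangeRestrict _),
    subsingleton_ext_one_of_exists_extension (RHom.map_injective P.ε_injective)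
      (exact_homImage P) (LinearMap.surjective_rangeRestrict _) (subsingleton_ext_I₀ P hω 0)⟩

/-- Compare `ω ⊗ Hom_R(ω, -)` of the copresentation with the copresentation itself. The two
injectivity assumptions make the upper row left exact, and `θ` is bijective at `I⁰` and `I¹`. -/
theorem θ_bijective_of_tens_injective
    (hK : Function.Injective (Tens.map R S ω (homImage S ω P).subtype))
    (hM : Function.Injective (Tens.map R S ω (RHom.map (ω := ω) S P.ε.hom))) :
    Function.Bijective (θ R S ω M) := by
  have h₀ := θ_bijective_I₀ P hω
  constructor
  · intro s t hst
    apply hM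
    apply h₀.1
    rw [θ_naturality, θ_naturality, hst]
  · intro m
    obtain ⟨t, ht⟩ := h₀.2 (P.ε.hom m)
    have h1 : Tens.map R S ω (RHom.map (ω := ω) S P.f.hom) t = 0 := by
      apply (θ_bijective_I₁ P hω).1
      rw [θ_naturality, ht, map_zero]
      exact P.exact.apply_apply_eq_zero m
    have h2 : Tens.map R S ω (RHom.map (ω := ω) S P.f.hom).rangeRestrict t = 0 := by
      apply hK
      rw [Tens.map_comp_apply, map_zero]
      exact h1
    obtain ⟨s, rfl⟩ := Tens.map_exact R S ω (exact_homImage P)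
      (LinearMap.surjective_rangeRestrict _) t h2
    rw [θ_naturality] at ht
    exact ⟨s, P.ε_injective ht⟩

theorem tens_injective_of_θ_bijective (hM : Function.Bijective (θ R S ω M)) :
    Function.Injective (Tens.map R S ω (homImage S ω P).subtype) ∧
      Function.Injective (Tens.map R S ω (RHom.map (ω := ω) S P.ε.hom)) := by
  constructor
  · refine (injective_iff_map_eq_zero _).2 fun z hz => ?_
    obtain ⟨t, rfl⟩ := Tens.map_surjective R S ω
      (LinearMap.surjective_rangeRestrict (RHom.map (ω := ω) S P.f.hom)) z
    rw [Tens.map_comp_apply] at hz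
    have h1 : P.f.hom (θ R S ω P.I₀ t) = 0 := by
      rw [← θ_naturality]
      exact (congrArg (θ R S ω P.I₁) hz).trans (map_zero _)
    obtain ⟨m, hm⟩ := (P.exact _).1 h1
    obtain ⟨s, rfl⟩ := hM.2 m
    have h2 : Tens.map R S ω (RHom.map S P.ε.hom) s = t := by
      apply (θ_bijective_I₀ P hω).1
      rw [θ_naturality]
      exact hm
    rw [← h2, Tens.map_comp_apply, (exact_homImage P).linearMap_comp_eq_zero]
    -- Here `x ⊗ 0 = 0` comes from additivity at `0 + 0`.
    exact DFunLike.congr_fun (Tens.hom_ext R S ω (f := Tens.map R S ω (0 : _ →ₗ[S] homImage S ω P))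
      (g := 0) fun x y => by
        simpa using! Tens.tmul_add R S ω x (0 : homImage S ω P) 0) s
  · intro s t hst
    have h := congrArg (θ R S ω P.I₀) hst
    rw [θ_naturality, θ_naturality] at h
    exact hM.1 (P.ε_injective h)

end Copresentation

/-- `M` is `∞`-`ω`-cotorsionfree if and only if `θ_M` is an isomorphism and
`Ext^i(Hom_R(ω, M), ω⁺) = 0` for `i ≥ 1`. -/
theorem cT_iff (hω : IsSemidualizing R S ω) (M : ModuleCat.{u} R) :
    cT R S ω M ↔ Function.Bijective (θ R S ω M) ∧
      ∀ i : ℕ, Subsingleton (Abelian.Ext (ModuleCat.of S (RHom R ω M))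
        (ModuleCat.of S (CharDual ω)) (i + 1)) := by
  constructor
  · intro h
    constructor
    · obtain ⟨P, hP⟩ := h 2
      have h1 := (isZero_tor_iff R S ω _ 0).1 (hP 1 le_rfl (by omega))
      have h2 := (isZero_tor_iff R S ω _ 1).1 (hP 2 (by omega) le_rfl)
      exact θ_bijective_of_tens_injective P hω ((subsingleton_ext_cotranspose_one P hω).1 h1)
        ((subsingleton_ext_homImage_one P hω).1
          ((subsingleton_ext_cotranspose_succ P hω 0).1 h2))
    · intro i
      obtain ⟨P, hP⟩ := h (i + 3)
      rw [← subsingleton_ext_homImage_succ P hω, ← subsingleton_ext_cotranspose_succ P hω]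
      exact (isZero_tor_iff R S ω _ (i + 2)).1 (hP (i + 3) (by omega) le_rfl)
  · rintro ⟨hM, hext⟩ n
    obtain ⟨P⟩ := nonempty_minimalInjectiveCopresentation M
    obtain ⟨hK, hε⟩ := tens_injective_of_θ_bijective P hω hM
    refine ⟨P, fun i hi _ => ?_⟩
    obtain ⟨i, rfl⟩ := Nat.exists_eq_add_of_le' hi
    rw [isZero_tor_iff]
    match i with
    | 0 => exact (subsingleton_ext_cotranspose_one P hω).2 hK
    | 1 =>
      exact (subsingleton_ext_cotranspose_succ P hω 0).2
        ((subsingleton_ext_homImage_one P hω).2 hε)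
    | i + 2 =>
      exact (subsingleton_ext_cotranspose_succ P hω (i + 1)).2
        ((subsingleton_ext_homImage_succ P hω i).2 (hext i))

theorem cT.homFunctor_obj (hω : IsSemidualizing R S ω) {M : ModuleCat.{u} R}
    (hM : cT R S ω M) : H R S ω ((homFunctor R S ω).obj M) := by
  rw [cT_iff hω] at hM
  refine ⟨μ_bijective_of_θ_bijective R S ω hM.1, fun i hi => ?_⟩
  obtain ⟨i, rfl⟩ := Nat.exists_eq_add_of_le' hi
  exact hM.2 i

/-- The isomorphism `N ≅ Hom_R(ω, ω ⊗_S N)` for an adstatic module `N`. -/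
def adstaticIso {N : ModuleCat.{u} S} (hN : IsAdstatic R S ω N) :
    N ≅ (homFunctor R S ω).obj ((tensorFunctor R S ω).obj N) :=
  (LinearEquiv.ofBijective (μ R S ω N) hN).toModuleIso

/-- The isomorphism `ω ⊗_S Hom_R(ω, M) ≅ M` for a module `M` such that `θ_M` is bijective. -/
def staticIso {M : ModuleCat.{u} R} (hM : Function.Bijective (θ R S ω M)) :
    (tensorFunctor R S ω).obj ((homFunctor R S ω).obj M) ≅ M :=
  (LinearEquiv.ofBijective (θ R S ω M) hM).toModuleIso

theorem H.tensorFunctor_obj (hω : IsSemidualizing R S ω) {N : ModuleCat.{u} S}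
    (hN : H R S ω N) : cT R S ω ((tensorFunctor R S ω).obj N) := by
  rw [cT_iff hω]
  refine ⟨θ_bijective_of_isAdstatic R S ω hN.1, fun i => subsingleton_of_forall_eq 0 fun x => ?_⟩
  have := hN.2 (i + 1) (by omega)
  let e := adstaticIso hN.1
  -- The class is transported along `N ≅ Hom_R(ω, ω ⊗_S N)` to a class on `N`, which vanishes.
  change Abelian.Ext ((homFunctor R S ω).obj ((tensorFunctor R S ω).obj N)) _ _ at x
  change x = 0
  rw [← Abelian.Ext.mk₀_id_comp x, ← e.inv_hom_id, ← Abelian.Ext.mk₀_comp_mk₀_assoc,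
    Subsingleton.elim ((Abelian.Ext.mk₀ e.hom).comp x (zero_add _)) 0, Abelian.Ext.comp_zero]

end Cotorsionfree

end

end Semidualizing

/-! ### The equivalence of categories -/

open Semidualizing in
theorem theorem3p3 (R S ω : Type u) [Ring R] [Ring S] [AddCommGroup ω] [Module R ω]
    [Module Sᵐᵒᵖ ω] [SMulCommClass R Sᵐᵒᵖ ω] (hω : IsSemidualizing R S ω) :
    ∃ (hF : ∀ M : (cT R S ω).FullSubcategory, H R S ω ((homFunctor R S ω).obj M.obj))
      (hG : ∀ N : (H R S ω).FullSubcategory, cT R S ω ((tensorFunctor R S ω).obj N.obj))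
      (e : (cT R S ω).FullSubcategory ≌ (H R S ω).FullSubcategory),
      e.functor = (H R S ω).lift ((cT R S ω).ι ⋙ homFunctor R S ω) hF ∧
      e.inverse = (cT R S ω).lift ((H R S ω).ι ⋙ tensorFunctor R S ω) hG := by
  -- The unit isomorphism is the inverse of `θ` and the counit isomorphism the inverse of `μ`;
  -- naturality is checked in the forward directions, where the formulas are explicit.
  refine ⟨fun M => cT.homFunctor_obj hω M.property, fun N => H.tensorFunctor_obj hω N.property,
    CategoryTheory.Equivalence.mk _ _
      (NatIso.ofComponents (fun M => (cT R S ω).isoMk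
        (staticIso ((cT_iff hω M.obj).1 M.property).1)) fun f => ?_).symm
      (NatIso.ofComponents (fun N => (H R S ω).isoMk (adstaticIso N.property.1))
        fun f => ?_).symm, rfl, rfl⟩
  · exact ObjectProperty.hom_ext _ (ModuleCat.hom_ext (Tens.hom_ext R S ω fun _ _ => rfl))
  · rfl
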